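/- Let $\mathbb F_n^+$ be the free semigroup with unit $g_0$ on generators $g_1,\dots,g_n$, let $|\alpha|$ be the length of a word $\alpha$, and put $X_\alpha:=X_{i_1}\cdots X_{i_k}$ for $\alpha=g_{i_1}\cdots g_{i_k}$, $X_{g_0}:=I$. Let $F^2(H_n)$ be the full Fock space on $n$ generators with its orthonormal basis $\{e_\alpha\}_{\alpha\in\mathbb F_n^+}$. Let $g=1+\sum_{|\alpha|\ge1}b_\alpha Z_\alpha$ be a formal power series in noncommuting indeterminates with $b_\alpha>0$, $b_{g_0}=1$ and $\sup_\alpha b_\alpha/b_{g_i\alpha}<\infty$ for each $i$. Let $\mathbf W=(W_1,\dots,W_n)$ be the weighted left creation operators $W_ie_\alpha=\sqrt{b_\alpha/b_{g_i\alpha}}\,e_{g_i\alpha}$ on $F^2(H_n)$, and let $g^{-1}=1+\sum_{|\alpha|\ge1}a_\alpha Z_\alpha$ be the inverse of $g$. Assume that $g$ is admissible, i.e. in addition * $g$ is free holomorphic in a neighborhood of the origin: for some $\rho>0$ the series $\sum_{k}\sum_{|\alpha|=k}b_\alpha X_\alpha$ converges in norm for all operators $X_1,\dots,X_n$ on a Hilbert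 space with $\|\sum_iX_iX_i^*\|^{1/2}\le\rho$; * $\sup_k\big\|\sum_{p=0}^k\sum_{|\alpha|=p}a_\alpha W_\alpha W_\alpha^*\big\|<\infty$. For a Hilbert space $\mathcal H$ and $X=(X_1,\dots,X_n)\in B(\mathcal H)^n$ let $\Delta_{g^{-1}}(X,X^*):=\sum_{p=0}^\infty\sum_{|\alpha|=p}a_\alpha X_\alpha X_\alpha^*$ (weak operator topology, when convergent). Let $\mathcal D_{g^{-1}}(\mathcal H)$ be the set of those $X$ for which this series converges, $\Delta_{g^{-1}}(X,X^*)\ge0$, and $\sum_{\alpha}b_\alpha X_\alpha\Delta_{g^{-1}}(X,X^*)X_\alpha^*$ converges in the weak operator topology to an operator $\le I$. Such an $X$ is called pure if the last sum equals $I$, and a Cuntz tuple if $\Delta_{g^{-1}}(X,X^*)=0$. For $X\in\mathcal D_{g^{-1}}(\mathcal H)$ the noncommutative Berezin kernel is the operator $K_{g,X}:\mathcal H\to F^2(H_n)\otimes\overline{\Delta_{g^{-1}}(X,X^*)\mathcal H}$, $$K_{g,X}h=\sum_\alpha\sqrt{b_\alpha}\,e_\alpha\otimes\Delta_{g^{-1}}(X,X^*)^{1/2}X_\alpha^*h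 .$$ **Theorem.** Suppose moreover that $\sum_{k=0}^\infty\sum_{|\alpha|=k}a_\alpha W_\alpha W_\alpha^*$ converges in the operator norm. Let $C^*(\mathbf W)$ be the $C^*$-algebra generated by $W_1,\dots,W_n$ and the identity, let $\pi$ be a unital $*$-representation of $C^*(\mathbf W)$ on a separable Hilbert space $\mathcal K$, and put $V_i:=\pi(W_i)$, $V=(V_1,\dots,V_n)$. Then $V\in\mathcal D_{g^{-1}}(\mathcal K)$ and $K_{g,V}$ is a partial isometry. With $$\mathcal K^{(0)}:=\operatorname{range}K_{g,V}^*,\qquad \mathcal K^{(1)}:=\ker K_{g,V},$$ $\mathcal K=\mathcal K^{(0)}\oplus\mathcal K^{(1)}$ is an orthogonal decomposition into closed subspaces such that 1. $\mathcal K^{(0)}$ and $\mathcal K^{(1)}$ are reducing for each $V_i$; 2. $V|_{\mathcal K^{(0)}}$ is a pure tuple in $\mathcal D_{g^{-1}}(\mathcal K^{(0)})$; 3. $V|_{\mathcal K^{(1)}}$ is a Cuntz tuple in $\mathcal D_{g^{-1}}(\mathcal K^{(1)})$. Moreover, $\Delta_{g^{-1}}(V,V^*)$ is an orthogonal projection and,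 with $\mathcal D:=\operatorname{range}\Delta_{g^{-1}}(V,V^*)$ (a closed subspace), the restriction $K_{g,V}|_{\mathcal K^{(0)}}:\mathcal K^{(0)}\to F^2(H_n)\otimes\mathcal D$ is unitary and $$V_i|_{\mathcal K^{(0)}}=\big(K_{g,V}|_{\mathcal K^{(0)}}\big)^*(W_i\otimes I_{\mathcal D})\big(K_{g,V}|_{\mathcal K^{(0)}}\big),\qquad i=1,\dots,n.$$ The decomposition is unique: if $\mathcal K=\mathcal M\oplus\mathcal N$ is an orthogonal decomposition into closed subspaces with the properties 1, 2 and 3 (for $\mathcal M,\mathcal N$ in place of $\mathcal K^{(0)},\mathcal K^{(1)}$), then $\mathcal M=\mathcal K^{(0)}$ and $\mathcal N=\mathcal K^{(1)}$. Finally, as orthogonal direct sums of closed subspaces, $$\mathcal K^{(0)}=\bigoplus_{\alpha\in\mathbb F_n^+}V_\alpha\mathcal D,\qquad \mathcal D=\mathcal K\ominus\Big(\bigoplus_{i=1}^n\overline{V_i\mathcal K}\Big),\qquad \mathcal K^{(1)}=\bigcap_{s=0}^\infty\ \bigoplus_{|\alpha|=s}\overline{V_\alpha\mathcal K}.$$ 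-/

import Mathlib

open Filter Topology

namespace NCDomain

noncomputable section

/-! ### Words and formal power series

The free semigroup with unit on `n` generators is `FreeMonoid (Fin n)`; a formal power series
`∑ f α Z_α` with real coefficients is the function `f : FreeMonoid (Fin n) → ℝ`. -/

/-- The finite set of the words of length `k`. -/
def words (n k : ℕ) : Finset (FreeMonoid (Fin n)) :=
  (List.finite_length_eq (Fin n) k).toFinset

theorem mem_words {n k : ℕ} {α : FreeMonoid (Fin n)} : α ∈ words n k ↔ α.length = k := by
  have h : α ∈ words n k ↔ α ∈ {l : List (Fin n) | l.length = k} :=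
    Set.Finite.mem_toFinset _
  exact h

/-- `X_α = X_{i₁} ⋯ X_{iₖ}` for `α = g_{i₁} ⋯ g_{iₖ}`, and `X_α = 1` for the empty word. -/
def word {n : ℕ} {A : Type*} [Monoid A] (X : Fin n → A) (α : FreeMonoid (Fin n)) : A :=
  FreeMonoid.lift X α

/-- Product of formal power series: the coefficient at `γ` is the sum of `f α * h β` over all
factorizations `γ = α β`, i.e. over all the places at which the word `γ` can be cut. -/
def seriesMul {n : ℕ} (f h : FreeMonoid (Fin n) → ℝ) (γ : FreeMonoid (Fin n)) : ℝ :=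
  ∑ k ∈ Finset.range (γ.length + 1),
    f (FreeMonoid.ofList (γ.toList.take k)) * h (FreeMonoid.ofList (γ.toList.drop k))

open Classical in
/-- The formal power series `1`. -/
def seriesOne {n : ℕ} (γ : FreeMonoid (Fin n)) : ℝ := if γ = 1 then 1 else 0

open Classical in
/-- The coefficients of the inverse `f⁻¹` of a formal power series `f` with constant term `1`:
the solution of `f⁻¹ f = 1`, by recursion on the length of the word. -/
def invCoeff {n : ℕ} (f : FreeMonoid (Fin n) → ℝ) (γ : FreeMonoid (Fin n)) : ℝ :=
  if γ = 1 then 1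
  else - ∑ k : Fin γ.length, invCoeff f (FreeMonoid.ofList (γ.toList.take k)) *
    f (FreeMonoid.ofList (γ.toList.drop k))
termination_by γ.length
decreasing_by
  have := k.2
  simp only [FreeMonoid.length, FreeMonoid.toList_ofList, List.length_take] at this ⊢
  omega

theorem invCoeff_mul {n : ℕ} {f : FreeMonoid (Fin n) → ℝ} (hf : f 1 = 1) :
    seriesMul (invCoeff f) f = seriesOne := by
  funext γ
  by_cases h : γ = 1
  · subst h
    have h1 : FreeMonoid.ofList ([] : List (Fin n)) = 1 := rfl
    simp [seriesMul, seriesOne, h1, hf, invCoeff]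
  · rw [seriesMul, Finset.sum_range_succ, seriesOne, if_neg h]
    have h1 : γ.toList.take γ.length = γ.toList := List.take_length
    have h2 : γ.toList.drop γ.length = [] := List.drop_length
    have h3 : FreeMonoid.ofList ([] : List (Fin n)) = 1 := rfl
    rw [h1, h2, h3, hf, mul_one, FreeMonoid.ofList_toList]
    conv_lhs => rw [invCoeff.eq_1 f γ]
    rw [if_neg h, Fin.sum_univ_eq_sum_range (fun k => invCoeff f
      (FreeMonoid.ofList (γ.toList.take k)) * f (FreeMonoid.ofList (γ.toList.drop k)))]
    ring

theorem seriesMul_assoc {n : ℕ} (f g h : FreeMonoid (Fin n) → ℝ) :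
    seriesMul (seriesMul f g) h = seriesMul f (seriesMul g h) := by
  funext γ
  simp only [seriesMul, Finset.sum_mul, Finset.mul_sum]
  rw [Finset.sum_sigma', Finset.sum_sigma']
  refine Finset.sum_bij' (fun p _ => ⟨p.2, p.1 - p.2⟩) (fun p _ => ⟨p.1 + p.2, p.1⟩) ?_ ?_ ?_ ?_ ?_
  · rintro ⟨k, j⟩ hp
    simp only [Finset.mem_sigma, Finset.mem_range, FreeMonoid.length, FreeMonoid.toList_ofList,
      List.length_take, List.length_drop] at hp ⊢
    omega
  · rintro ⟨k, j⟩ hp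
    simp only [Finset.mem_sigma, Finset.mem_range, FreeMonoid.length, FreeMonoid.toList_ofList,
      List.length_take, List.length_drop] at hp ⊢
    omega
  · rintro ⟨k, j⟩ hp
    simp only [Finset.mem_sigma, Finset.mem_range, FreeMonoid.length, FreeMonoid.toList_ofList,
      List.length_take] at hp ⊢
    have : j + (k - j) = k := by omega
    simp [this]
  · rintro ⟨k, j⟩ hp
    simp
  · rintro ⟨k, j⟩ hp
    simp only [Finset.mem_sigma, Finset.mem_range, FreeMonoid.length, FreeMonoid.toList_ofList,
      List.length_take] at hp ⊢
    have h1 : min j k = j := by omega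
    have h2 : j + (k - j) = k := by omega
    rw [List.take_take, List.drop_take, List.drop_drop, h1, h2, mul_assoc]

theorem seriesOne_mul {n : ℕ} (f : FreeMonoid (Fin n) → ℝ) : seriesMul seriesOne f = f := by
  funext γ
  rw [seriesMul, Finset.sum_eq_single 0]
  · have h1 : FreeMonoid.ofList ([] : List (Fin n)) = 1 := rfl
    simp [seriesOne, h1]
  · intro k hk hk0
    have : FreeMonoid.ofList (γ.toList.take k) ≠ 1 := by
      intro h
      have h2 := congrArg FreeMonoid.length h
      simp only [Finset.mem_range, FreeMonoid.length, FreeMonoid.toList_ofList,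
        List.length_take, FreeMonoid.toList_one, List.length_nil] at h2 hk
      omega
    simp [seriesOne, this]
  · simp

theorem seriesMul_one {n : ℕ} (f : FreeMonoid (Fin n) → ℝ) : seriesMul f seriesOne = f := by
  funext γ
  rw [seriesMul, Finset.sum_eq_single γ.length]
  · have h1 : γ.toList.take γ.length = γ.toList := List.take_length
    have h2 : γ.toList.drop γ.length = [] := List.drop_length
    have h3 : FreeMonoid.ofList ([] : List (Fin n)) = 1 := rfl
    simp [seriesOne, h1, h2, h3]
  · intro k hk hk0
    have : FreeMonoid.ofList (γ.toList.drop k) ≠ 1 := by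
      intro h
      have h2 := congrArg FreeMonoid.length h
      simp only [Finset.mem_range, FreeMonoid.length, FreeMonoid.toList_ofList,
        List.length_drop, FreeMonoid.toList_one, List.length_nil] at h2 hk hk0
      omega
    simp [seriesOne, this]
  · simp

theorem mul_invCoeff {n : ℕ} {f : FreeMonoid (Fin n) → ℝ} (hf : f 1 = 1) :
    seriesMul f (invCoeff f) = seriesOne := by
  have ha : invCoeff f 1 = 1 := by rw [invCoeff]; simp
  have h1 := invCoeff_mul hf
  have h2 := invCoeff_mul ha
  have h3 : invCoeff (invCoeff f) = f := by
    rw [← seriesMul_one (invCoeff (invCoeff f)), ← h1, ← seriesMul_assoc, h2, seriesOne_mul]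
  rw [h3] at h2
  exact h2

/-- The formal power series `∑ f α Z_α` is a free holomorphic function in a neighbourhood of the
origin: for some `ρ > 0` the series `∑ₖ ∑_{|α|=k} f α X_α` converges in norm for every tuple `X`
of operators on a Hilbert space with `‖∑ Xᵢ Xᵢ*‖^{1/2} ≤ ρ`. -/
def IsFreeHolomorphicNearZero {n : ℕ} (f : FreeMonoid (Fin n) → ℝ) : Prop :=
  ∃ ρ : ℝ, 0 < ρ ∧ ∀ (H : Type) [NormedAddCommGroup H] [InnerProductSpace ℂ H] [CompleteSpace H]
    (X : Fin n → H →L[ℂ] H), √‖∑ i, X i * star (X i)‖ ≤ ρ →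
      ∃ S : H →L[ℂ] H, Tendsto
        (fun N => ∑ k ∈ Finset.range N, ∑ α ∈ words n k, (f α : ℂ) • word X α) atTop (𝓝 S)

/-- A formal power series `g = 1 + ∑_{|α| ≥ 1} b_α Z_α` with strictly positive coefficients such
that `sup_α b_α / b_{g_i α} < ∞` for every `i`. -/
structure WeightSeries (n : ℕ) where
  coeff : FreeMonoid (Fin n) → ℝ
  pos : ∀ α, 0 < coeff α
  one : coeff 1 = 1
  bdd : ∀ i, BddAbove (Set.range fun α => coeff α / coeff (FreeMonoid.of i * α))

/-! ### Fock spaces and weighted left creation operators -/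

/-- `F²(Hₙ) ⊗ E`, in the orthonormal basis `e_α` of the full Fock space: the square summable
families of vectors of `E` indexed by the words. `F²(Hₙ)` itself is `Fock n ℂ`, and the vector
`e_α ⊗ x` is the family with the only non-zero entry `x`, at `α`. -/
abbrev Fock (n : ℕ) (E : Type*) [NormedAddCommGroup E] : Type _ :=
  lp (fun _ : FreeMonoid (Fin n) => E) 2

section Shift

variable {n : ℕ} {E : Type*} [NormedAddCommGroup E]

theorem summable_sq (f : Fock n E) : Summable fun α => ‖f α‖ ^ 2 := by
  have h := (lp.memℓp f).summable (by norm_num)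
  simpa using h

theorem norm_sq_eq (f : Fock n E) : ‖f‖ ^ 2 = ∑' α, ‖f α‖ ^ 2 := by
  have h := lp.norm_rpow_eq_tsum (p := 2) (by norm_num) f
  simpa using h

theorem memℓp_of_summable_sq {f : FreeMonoid (Fin n) → E} (h : Summable fun α => ‖f α‖ ^ 2) :
    Memℓp f 2 := memℓp_gen (by simpa using h)

variable [InnerProductSpace ℂ E]

/-- The coordinates of `(W_i ⊗ I) f`: at `g_i α` the entry is `√(b_α / b_{g_i α}) f_α`, at the
words that do not begin with `g_i` it is `0`. -/
def shiftFun (g : WeightSeries n) (i : Fin n) (f : FreeMonoid (Fin n) → E) :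
    FreeMonoid (Fin n) → E :=
  Function.extend (fun α => FreeMonoid.of i * α)
    (fun α => ((√(g.coeff α / g.coeff (FreeMonoid.of i * α)) : ℝ) : ℂ) • f α) 0

theorem cons_injective (i : Fin n) :
    Function.Injective (fun α : FreeMonoid (Fin n) => FreeMonoid.of i * α) :=
  fun _ _ h => mul_left_cancel h

theorem shiftFun_cons (g : WeightSeries n) (i : Fin n) (f : FreeMonoid (Fin n) → E)
    (α : FreeMonoid (Fin n)) : shiftFun g i f (FreeMonoid.of i * α) =
      ((√(g.coeff α / g.coeff (FreeMonoid.of i * α)) : ℝ) : ℂ) • f α :=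
  (cons_injective i).extend_apply _ _ α

theorem shiftFun_of_notMem (g : WeightSeries n) (i : Fin n) (f : FreeMonoid (Fin n) → E)
    {γ : FreeMonoid (Fin n)} (h : ¬ ∃ α, FreeMonoid.of i * α = γ) : shiftFun g i f γ = 0 :=
  Function.extend_apply' _ _ _ h

theorem norm_sq_shiftFun_le (g : WeightSeries n) (i : Fin n) :
    ∃ C : ℝ, 0 ≤ C ∧ ∀ (f : FreeMonoid (Fin n) → E) α,
      ‖shiftFun g i f (FreeMonoid.of i * α)‖ ^ 2 ≤ C * ‖f α‖ ^ 2 := by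
  obtain ⟨C, hC⟩ := g.bdd i
  have hC' : ∀ α, g.coeff α / g.coeff (FreeMonoid.of i * α) ≤ C := fun α => hC ⟨α, rfl⟩
  have h0 : ∀ α, 0 ≤ g.coeff α / g.coeff (FreeMonoid.of i * α) :=
    fun α => (div_pos (g.pos _) (g.pos _)).le
  refine ⟨C, (h0 1).trans (hC' 1), fun f α => ?_⟩
  rw [shiftFun_cons, norm_smul, mul_pow, Complex.norm_real, Real.norm_eq_abs, sq_abs,
    Real.sq_sqrt (h0 α)]
  exact mul_le_mul_of_nonneg_right (hC' α) (by positivity)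

theorem norm_sq_shiftFun_of_notMem (g : WeightSeries n) (i : Fin n) (f : FreeMonoid (Fin n) → E) :
    ∀ γ ∉ Set.range (fun α : FreeMonoid (Fin n) => FreeMonoid.of i * α),
      ‖shiftFun g i f γ‖ ^ 2 = 0 := by
  intro γ hγ
  rw [shiftFun_of_notMem g i f (by simpa using hγ)]
  simp

theorem memℓp_shiftFun (g : WeightSeries n) (i : Fin n) (f : Fock n E) :
    Memℓp (shiftFun g i f) 2 := by
  obtain ⟨C, -, hC⟩ := norm_sq_shiftFun_le (E := E) g i
  refine memℓp_of_summable_sq ?_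
  rw [← (cons_injective i).summable_iff (norm_sq_shiftFun_of_notMem g i f)]
  exact Summable.of_nonneg_of_le (fun _ => sq_nonneg _) (fun α => hC f α)
    ((summable_sq f).mul_left C)

theorem shiftFun_add (g : WeightSeries n) (i : Fin n) (f h : FreeMonoid (Fin n) → E) :
    shiftFun g i (f + h) = shiftFun g i f + shiftFun g i h := by
  funext γ
  by_cases hγ : ∃ α, FreeMonoid.of i * α = γ
  · obtain ⟨α, rfl⟩ := hγ
    simp only [Pi.add_apply, shiftFun_cons, smul_add]
  · simp only [Pi.add_apply, shiftFun_of_notMem _ _ _ hγ, add_zero]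

theorem shiftFun_smul (g : WeightSeries n) (i : Fin n) (c : ℂ) (f : FreeMonoid (Fin n) → E) :
    shiftFun g i (c • f) = c • shiftFun g i f := by
  funext γ
  by_cases hγ : ∃ α, FreeMonoid.of i * α = γ
  · obtain ⟨α, rfl⟩ := hγ
    simp only [Pi.smul_apply, shiftFun_cons]
    rw [smul_comm]
  · simp only [Pi.smul_apply, shiftFun_of_notMem _ _ _ hγ, smul_zero]

variable (E) in
/-- The operator `W_i ⊗ I_E` on `F²(Hₙ) ⊗ E`:
`e_α ⊗ x ↦ √(b_α / b_{g_i α}) e_{g_i α} ⊗ x`. -/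
def shift (g : WeightSeries n) (i : Fin n) : Fock n E →L[ℂ] Fock n E :=
  LinearMap.mkContinuousOfExistsBound
    { toFun := fun f => ⟨shiftFun g i f, memℓp_shiftFun g i f⟩
      map_add' := fun f h => Subtype.ext (shiftFun_add g i f h)
      map_smul' := fun c f => Subtype.ext (shiftFun_smul g i c f) }
    (by
      obtain ⟨C, hC0, hC⟩ := norm_sq_shiftFun_le (E := E) g i
      refine ⟨√C, fun f => ?_⟩
      refine le_of_sq_le_sq ?_ (by positivity)
      rw [mul_pow, Real.sq_sqrt hC0, norm_sq_eq, norm_sq_eq, ← tsum_mul_left]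
      have hs := summable_sq (⟨shiftFun g i f, memℓp_shiftFun g i f⟩ : Fock n E)
      change ∑' γ, ‖shiftFun g i f γ‖ ^ 2 ≤ _
      rw [← (cons_injective i).tsum_eq (f := fun γ => ‖shiftFun g i f γ‖ ^ 2)]
      · refine Summable.tsum_le_tsum (fun α => hC f α) ?_ ((summable_sq f).mul_left C)
        exact hs.comp_injective (cons_injective i)
      · intro γ hγ
        by_contra h
        exact hγ (norm_sq_shiftFun_of_notMem g i f γ h))

theorem shift_apply (g : WeightSeries n) (i : Fin n) (f : Fock n E) (γ : FreeMonoid (Fin n)) :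
    shift E g i f γ = shiftFun g i f γ := rfl

/-- The elementary tensor `ξ ⊗ x` in `F²(Hₙ) ⊗ E`. -/
def tmul (ξ : Fock n ℂ) (x : E) : Fock n E :=
  ⟨fun α => ξ α • x, memℓp_of_summable_sq (by
    simpa [norm_smul, mul_pow] using (summable_sq ξ).mul_right (‖x‖ ^ 2))⟩

theorem tmul_apply (ξ : Fock n ℂ) (x : E) (α : FreeMonoid (Fin n)) : tmul ξ x α = ξ α • x := rfl

theorem inner_tmul (ξ η : Fock n ℂ) (x y : E) :
    inner ℂ (tmul ξ x) (tmul η y) = inner ℂ ξ η * inner ℂ x y := by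
  rw [lp.inner_eq_tsum, lp.inner_eq_tsum, ← tsum_mul_right]
  refine tsum_congr fun α => ?_
  rw [tmul_apply, tmul_apply, inner_smul_left, inner_smul_right, RCLike.inner_apply]
  ring

theorem shift_tmul (g : WeightSeries n) (i : Fin n) (ξ : Fock n ℂ) (x : E) :
    shift E g i (tmul ξ x) = tmul (shift ℂ g i ξ) x := by
  ext γ
  rw [shift_apply, tmul_apply, shift_apply]
  by_cases hγ : ∃ α, FreeMonoid.of i * α = γ
  · obtain ⟨α, rfl⟩ := hγ
    rw [shiftFun_cons, shiftFun_cons, tmul_apply, smul_assoc]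
  · rw [shiftFun_of_notMem _ _ _ hγ, shiftFun_of_notMem _ _ _ hγ, zero_smul]

end Shift

/-- The weighted left creation operators `W = (W_1, …, W_n)` associated with `g`, on `F²(Hₙ)`. -/
abbrev universalModel {n : ℕ} (g : WeightSeries n) : Fin n → Fock n ℂ →L[ℂ] Fock n ℂ :=
  shift ℂ g

/-! ### The noncommutative domain of `g⁻¹` -/

section Domain

variable {n : ℕ} {H : Type*} [NormedAddCommGroup H] [InnerProductSpace ℂ H] [CompleteSpace H]

/-- The partial sum `∑_{p < N} ∑_{|α| = p} a_α X_α X_α*`, where `g⁻¹ = ∑ a_α Z_α`. -/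
def defectPartialSum (g : WeightSeries n) (X : Fin n → H →L[ℂ] H) (N : ℕ) : H →L[ℂ] H :=
  ∑ p ∈ Finset.range N, ∑ α ∈ words n p,
    (invCoeff g.coeff α : ℂ) • (word X α * star (word X α))

/-- `∑_p ∑_{|α| = p} a_α X_α X_α* = D`, in the weak operator topology. -/
def HasDefect (g : WeightSeries n) (X : Fin n → H →L[ℂ] H) (D : H →L[ℂ] H) : Prop :=
  Tendsto (fun N => ContinuousLinearMapWOT.ofCLM (defectPartialSum g X N)) atTop
    (𝓝 (ContinuousLinearMapWOT.ofCLM D))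

open Classical in
/-- The operator `Δ_{g⁻¹}(X, X*)`, the sum in the weak operator topology of
`∑_p ∑_{|α| = p} a_α X_α X_α*` (and `0` by convention if this series diverges). -/
def defect (g : WeightSeries n) (X : Fin n → H →L[ℂ] H) : H →L[ℂ] H :=
  if h : ∃ D, HasDefect g X D then h.choose else 0

theorem HasDefect.defect_eq {g : WeightSeries n} {X : Fin n → H →L[ℂ] H} {D : H →L[ℂ] H}
    (h : HasDefect g X D) : defect g X = D := by
  have hex : ∃ D, HasDefect g X D := ⟨D, h⟩
  rw [defect, dif_pos hex]
  exact ContinuousLinearMapWOT.ofCLM_injective (tendsto_nhds_unique hex.choose_spec h)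

/-- `∑_α b_α X_α Δ_{g⁻¹}(X, X*) X_α* = S`, in the weak operator topology. -/
def HasBerezinSum (g : WeightSeries n) (X : Fin n → H →L[ℂ] H) (S : H →L[ℂ] H) : Prop :=
  HasSum (fun α : FreeMonoid (Fin n) => ContinuousLinearMapWOT.ofCLM
      ((g.coeff α : ℂ) • (word X α * defect g X * star (word X α))))
    (ContinuousLinearMapWOT.ofCLM S)

/-- `X` belongs to the noncommutative domain of `g⁻¹` over `H`. -/
structure InDomain (g : WeightSeries n) (X : Fin n → H →L[ℂ] H) : Prop where
  hasDefect : HasDefect g X (defect g X)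
  defect_nonneg : 0 ≤ defect g X
  sum_le_one : ∃ S, HasBerezinSum g X S ∧ S ≤ 1

/-- Cuntz tuples in the domain. -/
def IsCuntz (g : WeightSeries n) (X : Fin n → H →L[ℂ] H) : Prop :=
  InDomain g X ∧ defect g X = 0

/-- Pure tuples in the domain. -/
def IsPure (g : WeightSeries n) (X : Fin n → H →L[ℂ] H) : Prop :=
  InDomain g X ∧ HasBerezinSum g X 1

/-! ### The noncommutative Berezin kernel -/

/-- The closure of the range of `Δ_{g⁻¹}(X, X*)`. -/
def defectSpace (g : WeightSeries n) (X : Fin n → H →L[ℂ] H) : Submodule ℂ H :=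
  (LinearMap.range (defect g X).toLinearMap).topologicalClosure

instance (g : WeightSeries n) (X : Fin n → H →L[ℂ] H) : CompleteSpace (defectSpace g X) :=
  (Submodule.isClosed_topologicalClosure _).completeSpace_coe

theorem sqrt_defect_norm_sq {D : H →L[ℂ] H} (hD : 0 ≤ D) (x : H) :
    ((‖CFC.sqrt D x‖ ^ 2 : ℝ) : ℂ) = inner ℂ x (D x) := by
  have h1 : CFC.sqrt D * CFC.sqrt D = D := CFC.sqrt_mul_sqrt_self D hD
  have h2 : IsSelfAdjoint (CFC.sqrt D) := (CFC.sqrt_nonneg D).isSelfAdjoint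
  conv_rhs => rw [← h1]
  rw [mul_apply_eq_comp, ← ContinuousLinearMap.adjoint_inner_left,
    ← ContinuousLinearMap.star_eq_adjoint, h2.star_eq, inner_self_eq_norm_sq_to_K]
  norm_cast

theorem sqrt_defect_mem (g : WeightSeries n) {X : Fin n → H →L[ℂ] H} (hX : 0 ≤ defect g X)
    (x : H) : CFC.sqrt (defect g X) x ∈ defectSpace g X := by
  have h2 : IsSelfAdjoint (CFC.sqrt (defect g X)) := (CFC.sqrt_nonneg _).isSelfAdjoint
  have h3 : IsSelfAdjoint (defect g X) := hX.isSelfAdjoint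
  rw [defectSpace, ← Submodule.orthogonal_orthogonal_eq_closure, Submodule.mem_orthogonal]
  intro y hy
  have h4 : defect g X y = 0 := by
    have := (Submodule.mem_orthogonal _ _).1 hy (defect g X (defect g X y)) ⟨_, rfl⟩
    rw [← ContinuousLinearMap.adjoint_inner_right, ← ContinuousLinearMap.star_eq_adjoint,
      h3.star_eq, inner_self_eq_zero] at this
    exact this
  have h5 : CFC.sqrt (defect g X) y = 0 := by
    have := sqrt_defect_norm_sq hX y
    rw [h4, inner_zero_right] at this
    have h6 : ‖CFC.sqrt (defect g X) y‖ ^ 2 = 0 := by exact_mod_cast this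
    simpa using h6
  rw [← ContinuousLinearMap.adjoint_inner_left, ← ContinuousLinearMap.star_eq_adjoint,
    h2.star_eq, h5, inner_zero_left]

/-- The component `√b_α Δ_{g⁻¹}(X, X*)^{1/2} X_α* h` of the Berezin kernel along `e_α`. -/
def kernelCoord (g : WeightSeries n) (X : Fin n → H →L[ℂ] H) (hX : InDomain g X) (h : H)
    (α : FreeMonoid (Fin n)) : defectSpace g X :=
  ((√(g.coeff α) : ℝ) : ℂ) • ⟨CFC.sqrt (defect g X) (star (word X α) h),
    sqrt_defect_mem g hX.defect_nonneg _⟩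

theorem norm_sq_kernelCoord (g : WeightSeries n) {X : Fin n → H →L[ℂ] H} (hX : InDomain g X)
    (h : H) (α : FreeMonoid (Fin n)) : ((‖kernelCoord g X hX h α‖ ^ 2 : ℝ) : ℂ) =
      inner ℂ h (((g.coeff α : ℂ) • (word X α * defect g X * star (word X α))) h) := by
  have h1 := sqrt_defect_norm_sq hX.defect_nonneg (star (word X α) h)
  rw [kernelCoord, norm_smul, mul_pow, Complex.norm_real, Real.norm_eq_abs, sq_abs,
    Real.sq_sqrt (g.pos α).le, Complex.ofReal_mul, Submodule.coe_norm, h1,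
    smul_apply, inner_smul_right, mul_apply_eq_comp,
    mul_apply_eq_comp, ContinuousLinearMap.star_eq_adjoint,
    ContinuousLinearMap.adjoint_inner_left]

theorem kernelCoord_bound (g : WeightSeries n) {X : Fin n → H →L[ℂ] H} (hX : InDomain g X)
    (h : H) : Summable (fun α => ‖kernelCoord g X hX h α‖ ^ 2) ∧
      ∑' α, ‖kernelCoord g X hX h α‖ ^ 2 ≤ ‖h‖ ^ 2 := by
  obtain ⟨S, hS, hS1⟩ := hX.sum_le_one
  have h1 : HasSum (fun α => ((‖kernelCoord g X hX h α‖ ^ 2 : ℝ) : ℂ)) (inner ℂ h (S h)) := by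
    have := ContinuousLinearMapWOT.tendsto_iff_forall_inner_apply_tendsto.1 hS h h
    refine this.congr fun s => ?_
    induction s using Finset.cons_induction with
    | empty => simp
    | cons a s ha ih =>
      rw [Finset.sum_cons, Finset.sum_cons, ContinuousLinearMapWOT.add_apply, inner_add_right, ih,
        norm_sq_kernelCoord]
      rfl
  have h2 := Complex.hasSum_re h1
  simp only [Complex.ofReal_re] at h2
  refine ⟨h2.summable, ?_⟩
  rw [h2.tsum_eq]
  have h3 := ((ContinuousLinearMap.le_def _ _).1 hS1).re_inner_nonneg_right h
  rw [sub_apply, inner_sub_right, one_apply_eq_self,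
    inner_self_eq_norm_sq_to_K, map_sub] at h3
  have h4 : RCLike.re ((‖h‖ : ℂ) ^ 2) = ‖h‖ ^ 2 := by norm_cast
  have h5 : RCLike.re (inner ℂ h (S h)) = (inner ℂ h (S h)).re := rfl
  erw [h4] at h3
  rw [h5] at h3
  linarith

/-- The noncommutative Berezin kernel `K_{g,X} : H → F²(Hₙ) ⊗ closure (Δ_{g⁻¹}(X, X*) H)`,
`K_{g,X} h = ∑_α √b_α e_α ⊗ Δ_{g⁻¹}(X, X*)^{1/2} X_α* h`, of a tuple in the domain. -/
def berezinKernel (g : WeightSeries n) (X : Fin n → H →L[ℂ] H) (hX : InDomain g X) :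
    H →L[ℂ] Fock n (defectSpace g X) :=
  LinearMap.mkContinuous
    { toFun := fun h => ⟨kernelCoord g X hX h, memℓp_of_summable_sq (kernelCoord_bound g hX h).1⟩
      map_add' := fun h h' => by
        refine Subtype.ext (funext fun α => Subtype.ext ?_)
        change (kernelCoord g X hX (h + h') α : H) =
          kernelCoord g X hX h α + kernelCoord g X hX h' α
        simp [kernelCoord]
      map_smul' := fun c h => by
        refine Subtype.ext (funext fun α => Subtype.ext ?_)
        change (kernelCoord g X hX (c • h) α : H) = c • (kernelCoord g X hX h α : H)
        simp only [kernelCoord, map_smul, Submodule.coe_smul]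
        exact smul_comm _ _ _ }
    1 (fun h => by
      rw [one_mul]
      refine le_of_sq_le_sq ?_ (norm_nonneg h)
      rw [norm_sq_eq]
      exact (kernelCoord_bound g hX h).2)

theorem berezinKernel_apply (g : WeightSeries n) (X : Fin n → H →L[ℂ] H) (hX : InDomain g X)
    (h : H) (α : FreeMonoid (Fin n)) :
    (berezinKernel g X hX h α : H) =
      ((√(g.coeff α) : ℝ) : ℂ) • CFC.sqrt (defect g X) (star (word X α) h) := rfl

end Domain

/-! ### Admissibility and the C*-algebra of the universal model -/

/-- `g` is an admissible free holomorphic function (the conditions on the coefficients alone are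
part of `WeightSeries`). -/
structure IsAdmissible {n : ℕ} (g : WeightSeries n) : Prop where
  freeHolomorphic : IsFreeHolomorphicNearZero g.coeff
  bounded : BddAbove (Set.range fun k => ‖defectPartialSum g (universalModel g) k‖)

/-- `C*(W)`: the C*-algebra generated by `W_1, …, W_n` and the identity. -/
def cstarModel {n : ℕ} (g : WeightSeries n) : StarSubalgebra ℂ (Fock n ℂ →L[ℂ] Fock n ℂ) :=
  (StarAlgebra.adjoin ℂ (Set.range (universalModel g))).topologicalClosure

theorem universalModel_mem {n : ℕ} (g : WeightSeries n) (i : Fin n) :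
    universalModel g i ∈ cstarModel g :=
  StarSubalgebra.le_topologicalClosure _ (StarAlgebra.subset_adjoin ℂ _ ⟨i, rfl⟩)

/-- The tuple `V = (π(W_1), …, π(W_n))`. -/
def repTuple {n : ℕ} (g : WeightSeries n) {K : Type*} [NormedAddCommGroup K]
    [InnerProductSpace ℂ K] [CompleteSpace K] (π : cstarModel g →⋆ₐ[ℂ] (K →L[ℂ] K)) :
    Fin n → K →L[ℂ] K :=
  fun i => π ⟨universalModel g i, universalModel_mem g i⟩

/-! ### Wold decompositions -/

section Wold

variable {n : ℕ} {K : Type*} [NormedAddCommGroup K] [InnerProductSpace ℂ K] [CompleteSpace K]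

/-- `T` is a partial isometry: it is isometric on the orthogonal complement of its kernel. -/
def IsPartialIsometry {L : Type*} [NormedAddCommGroup L] [InnerProductSpace ℂ L]
    (T : K →L[ℂ] L) : Prop :=
  ∀ x ∈ (LinearMap.ker T.toLinearMap)ᗮ, ‖T x‖ = ‖x‖

/-- `M` is a reducing subspace for `T`. -/
def Reduces (M : Submodule ℂ K) (T : K →L[ℂ] K) : Prop :=
  (∀ x ∈ M, T x ∈ M) ∧ ∀ x ∈ M, star T x ∈ M

/-- The restriction `(V_1|M, …, V_n|M)` of a tuple to a subspace that reduces it. -/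
def restrictTuple (V : Fin n → K →L[ℂ] K) (M : Submodule ℂ K) (hM : ∀ i, Reduces M (V i)) :
    Fin n → M →L[ℂ] M :=
  fun i => (V i).restrict (hM i).1

/-- `K = M ⊕ N` is an orthogonal decomposition into closed subspaces that reduce every `V_i`, such
that `V|M` is a pure tuple and `V|N` is a Cuntz tuple in the domain of `g⁻¹`. -/
structure IsWoldDecomposition (g : WeightSeries n) (V : Fin n → K →L[ℂ] K)
    (M N : Submodule ℂ K) : Prop where
  closed_left : IsClosed (M : Set K)
  closed_right : IsClosed (N : Set K)
  orthogonal : M ⟂ N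
  sup_eq_top : M ⊔ N = ⊤
  reduces_left : ∀ i, Reduces M (V i)
  reduces_right : ∀ i, Reduces N (V i)
  pure_left :
    haveI : CompleteSpace M := closed_left.completeSpace_coe
    IsPure g (restrictTuple V M reduces_left)
  cuntz_right :
    haveI : CompleteSpace N := closed_right.completeSpace_coe
    IsCuntz g (restrictTuple V N reduces_right)

/-- `S` is the Hilbert space (internal) orthogonal direct sum of the closed subspaces `F i`. -/
structure IsOrthogonalSum {ι : Type*} (F : ι → Submodule ℂ K) (S : Submodule ℂ K) : Prop where
  closed : ∀ i, IsClosed (F i : Set K)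
  orthogonal : Pairwise fun i j => F i ⟂ F j
  eq_closure : S = (⨆ i, F i).topologicalClosure

/-- The closure of the range of an operator. -/
def closedRange (T : K →L[ℂ] K) : Submodule ℂ K :=
  (LinearMap.range T.toLinearMap).topologicalClosure

end Wold

end

end NCDomain

open NCDomain

/-! ### The universal model in coordinates -/

namespace NCDomain

/-! Everything rests on one computation in Fock space. Each `W_α W_α*` is diagonal: its eigenvalue
is `b_β / b_{αβ}` at `e_{αβ}`, and `0` at basis vectors whose word does not begin with `α`. At `e_γ`
the partial sums of `∑ a_α W_α W_α*` therefore become constant beyond degree `|γ|`, with value `(g⁻¹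
g)_γ / b_γ`, and `g⁻¹ g = 1` makes the sum the projection `P` onto the vacuum. Norm convergence puts
`P` into `C*(W)`, so `π(P)` makes sense and is the defect `Δ` of `V`. The relations `W_i* P = 0`,
`W_α* W_β = 0` for distinct words of equal length, and `W_i* W_i W_α P = (b_α / b_{g_i α}) W_α P`
pass to `V` (`isModelTuple_repTuple`); nothing else about `π` is needed.

These relations give `V_α* V_α Δ = b_α⁻¹ Δ`, and `V_α* V_β Δ = 0` for `α ≠ β` with `|β| ≤ |α|`.
Hence the maps `x ↦ √b_α V_α x` are isometries of `𝒟 = Δ K` with mutually orthogonal ranges and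
assemble to an isometry `F²(Hₙ) ⊗ 𝒟 → K` (`woldIsometry`). It intertwines `W_i ⊗ I` with `V_i`, and
since `Δ^{1/2} = Δ`, its adjoint is the Berezin kernel (`berezinKernel_eq`). The kernel is thus a
co-isometry, its initial space `K⁽⁰⁾` is the closed span of the `V_α 𝒟`, and `∑ b_α V_α Δ V_α*` is
the projection onto `K⁽⁰⁾`.

Defects and Berezin sums of restrictions to reducing subspaces are compressions of those of `V`.
This yields purity on `K⁽⁰⁾`, vanishing defect on its complement, and uniqueness: a pure reducing
subspace lies in `K⁽⁰⁾`, a Cuntz one in `K⁽¹⁾`. The formulas for `𝒟` and `K⁽¹⁾` come from `Δ x = x`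
whenever all `V_i* x = 0` (`defect_eq_self`), used inductively on the word length. -/

theorem word_one {n : ℕ} {A : Type*} [Monoid A] (X : Fin n → A) : word X 1 = 1 :=
  map_one _

theorem word_mul {n : ℕ} {A : Type*} [Monoid A] (X : Fin n → A) (α β : FreeMonoid (Fin n)) :
    word X (α * β) = word X α * word X β :=
  map_mul _ _ _

theorem word_of {n : ℕ} {A : Type*} [Monoid A] (X : Fin n → A) (i : Fin n) :
    word X (FreeMonoid.of i) = X i :=
  FreeMonoid.lift_eval_of _ _

theorem map_word {n : ℕ} {A B F : Type*} [Monoid A] [Monoid B] [FunLike F A B]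
    [MonoidHomClass F A B] (φ : F) (X : Fin n → A) (α : FreeMonoid (Fin n)) :
    φ (word X α) = word (fun i => φ (X i)) α := by
  induction α using FreeMonoid.inductionOn' with
  | one => rw [word_one, word_one, map_one]
  | of_mul i α ih => rw [word_mul, word_mul, map_mul, ih, word_of, word_of]

theorem WeightSeries.ne_zero {n : ℕ} (g : WeightSeries n) (α : FreeMonoid (Fin n)) :
    (g.coeff α : ℂ) ≠ 0 :=
  Complex.ofReal_ne_zero.2 (g.pos α).ne'

theorem WeightSeries.sqrt_mul_sqrt {n : ℕ} (g : WeightSeries n) (α β γ : FreeMonoid (Fin n)) :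
    (√(g.coeff β / g.coeff γ) : ℂ) * (√(g.coeff α / g.coeff β) : ℂ) =
      (√(g.coeff α / g.coeff γ) : ℂ) := by
  rw [← Complex.ofReal_mul, ← Real.sqrt_mul (div_pos (g.pos _) (g.pos _)).le]
  have := (g.pos β).ne'
  have := (g.pos γ).ne'
  congr 2
  field_simp

theorem WeightSeries.sqrt_mul_self {n : ℕ} (g : WeightSeries n) (α β : FreeMonoid (Fin n)) :
    (√(g.coeff α / g.coeff β) : ℂ) * (√(g.coeff α / g.coeff β) : ℂ) =
      (g.coeff α : ℂ) / (g.coeff β : ℂ) := by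
  rw [← Complex.ofReal_mul, Real.mul_self_sqrt (div_pos (g.pos _) (g.pos _)).le,
    Complex.ofReal_div]

section Coordinates

variable {n : ℕ} (g : WeightSeries n)

theorem universalModel_apply_cons (i : Fin n) (f : Fock n ℂ) (α : FreeMonoid (Fin n)) :
    universalModel g i f (FreeMonoid.of i * α) =
      (√(g.coeff α / g.coeff (FreeMonoid.of i * α)) : ℂ) * f α :=
  shiftFun_cons g i f α

theorem universalModel_apply_of_not_exists (i : Fin n) (f : Fock n ℂ) {γ : FreeMonoid (Fin n)}
    (h : ¬ ∃ α, FreeMonoid.of i * α = γ) : universalModel g i f γ = 0 :=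
  shiftFun_of_notMem g i f h

open Classical in
theorem inner_single_one (α : FreeMonoid (Fin n)) (f : Fock n ℂ) :
    inner ℂ (lp.single 2 α (1 : ℂ) : Fock n ℂ) f = f α := by
  rw [lp.inner_single_left]
  simp

open Classical in
theorem universalModel_single (i : Fin n) (α : FreeMonoid (Fin n)) :
    universalModel g i (lp.single 2 α (1 : ℂ)) =
      (√(g.coeff α / g.coeff (FreeMonoid.of i * α)) : ℂ) •
        lp.single 2 (FreeMonoid.of i * α) (1 : ℂ) := by
  ext γ
  by_cases hγ : ∃ β, FreeMonoid.of i * β = γ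
  · obtain ⟨β, rfl⟩ := hγ
    rw [universalModel_apply_cons, lp.coeFn_smul, Pi.smul_apply, smul_eq_mul]
    by_cases h : β = α
    · subst h
      simp
    · have h' : FreeMonoid.of i * β ≠ FreeMonoid.of i * α := fun h' => h (mul_left_cancel h')
      simp [h]
  · rw [universalModel_apply_of_not_exists g i _ hγ, lp.coeFn_smul, Pi.smul_apply, smul_eq_mul]
    have h' : γ ≠ FreeMonoid.of i * α := fun h' => hγ ⟨α, h'.symm⟩
    simp [h']

theorem star_universalModel_apply (i : Fin n) (f : Fock n ℂ) (α : FreeMonoid (Fin n)) :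
    star (universalModel g i) f α =
      (√(g.coeff α / g.coeff (FreeMonoid.of i * α)) : ℂ) * f (FreeMonoid.of i * α) := by
  classical
  rw [← inner_single_one α (star (universalModel g i) f), ContinuousLinearMap.star_eq_adjoint,
    ContinuousLinearMap.adjoint_inner_right, universalModel_single, inner_smul_left,
    inner_single_one, Complex.conj_ofReal]

theorem word_universalModel_apply_mul (α : FreeMonoid (Fin n)) (f : Fock n ℂ)
    (β : FreeMonoid (Fin n)) : word (universalModel g) α f (α * β) =
      (√(g.coeff β / g.coeff (α * β)) : ℂ) * f β := by
  induction α using FreeMonoid.inductionOn' with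
  | one =>
    rw [word_one, one_mul, div_self (g.pos β).ne']
    simp
  | of_mul i α ih =>
    rw [word_mul, word_of, mul_apply_eq_comp, mul_assoc, universalModel_apply_cons, ih, ← mul_assoc (_ : ℂ),
      g.sqrt_mul_sqrt]

theorem word_universalModel_apply_of_not_exists (α : FreeMonoid (Fin n)) (f : Fock n ℂ)
    {γ : FreeMonoid (Fin n)} (h : ¬ ∃ β, α * β = γ) : word (universalModel g) α f γ = 0 := by
  induction α using FreeMonoid.inductionOn' generalizing γ with
  | one => exact absurd ⟨γ, one_mul γ⟩ h
  | of_mul i α ih =>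
    rw [word_mul, word_of, mul_apply_eq_comp]
    by_cases hγ : ∃ β, FreeMonoid.of i * β = γ
    · obtain ⟨δ, rfl⟩ := hγ
      rw [universalModel_apply_cons, ih, mul_zero]
      rintro ⟨β, rfl⟩
      exact h ⟨β, mul_assoc _ _ _⟩
    · exact universalModel_apply_of_not_exists g i _ hγ

theorem star_word_universalModel_apply (α : FreeMonoid (Fin n)) (f : Fock n ℂ)
    (β : FreeMonoid (Fin n)) : star (word (universalModel g) α) f β =
      (√(g.coeff β / g.coeff (α * β)) : ℂ) * f (α * β) := by
  induction α using FreeMonoid.inductionOn' generalizing f with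
  | one =>
    rw [word_one, one_mul, div_self (g.pos β).ne']
    simp
  | of_mul i α ih =>
    rw [word_mul, word_of, star_mul, mul_apply_eq_comp, ih, star_universalModel_apply, ← mul_assoc,
      mul_comm (√(g.coeff β / g.coeff (α * β)) : ℂ), g.sqrt_mul_sqrt, mul_assoc]

theorem word_mul_star_word_universalModel_apply_mul (α : FreeMonoid (Fin n)) (f : Fock n ℂ)
    (β : FreeMonoid (Fin n)) :
    (word (universalModel g) α * star (word (universalModel g) α)) f (α * β) =
      (g.coeff β / g.coeff (α * β) : ℂ) * f (α * β) := by
  rw [mul_apply_eq_comp, word_universalModel_apply_mul, star_word_universalModel_apply,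
    ← mul_assoc, g.sqrt_mul_self]

/-- Among the words of length `p` only the prefix of `γ` contributes at `γ`. Summed over `p`, these
contributions form the coefficient of `g⁻¹ g` at `γ`, divided by `b_γ`. -/
theorem sum_words_universalModel_apply (p : ℕ) (f : Fock n ℂ) (γ : FreeMonoid (Fin n)) :
    (∑ α ∈ words n p, (invCoeff g.coeff α : ℂ) •
      (word (universalModel g) α * star (word (universalModel g) α))) f γ =
    if p ≤ γ.length then
      (invCoeff g.coeff (FreeMonoid.ofList (γ.toList.take p)) *
        g.coeff (FreeMonoid.ofList (γ.toList.drop p)) / g.coeff γ : ℂ) * f γ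
    else 0 := by
  rw [sum_apply, lp.coeFn_sum, Finset.sum_apply]
  simp only [smul_apply, lp.coeFn_smul, Pi.smul_apply, smul_eq_mul]
  split_ifs with hp
  · have hγ : FreeMonoid.ofList (γ.toList.take p) * FreeMonoid.ofList (γ.toList.drop p) = γ :=
      List.take_append_drop p γ.toList
    rw [Finset.sum_eq_single (FreeMonoid.ofList (γ.toList.take p))]
    · have h := word_mul_star_word_universalModel_apply_mul g
        (FreeMonoid.ofList (γ.toList.take p)) f (FreeMonoid.ofList (γ.toList.drop p))
      rw [hγ] at h
      rw [h]
      ring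
    · intro α hα hne
      rw [mul_apply_eq_comp, word_universalModel_apply_of_not_exists, mul_zero]
      rintro ⟨β, rfl⟩
      refine hne ?_
      have hl : α.toList.length = p := mem_words.1 hα
      rw [FreeMonoid.toList_mul, ← hl, List.take_left, FreeMonoid.ofList_toList]
    · intro h
      refine absurd (mem_words.2 ?_) h
      exact List.length_take_of_le hp
  · refine Finset.sum_eq_zero fun α hα => ?_
    rw [mul_apply_eq_comp, word_universalModel_apply_of_not_exists, mul_zero]
    rintro ⟨β, rfl⟩
    rw [FreeMonoid.length_mul, mem_words.1 hα] at hp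
    omega

open Classical in
theorem defectPartialSum_universalModel_apply (f : Fock n ℂ) {γ : FreeMonoid (Fin n)} {N : ℕ}
    (hN : γ.length < N) :
    defectPartialSum g (universalModel g) N f γ = if γ = 1 then f γ else 0 := by
  rw [defectPartialSum, sum_apply, lp.coeFn_sum, Finset.sum_apply]
  simp only [sum_words_universalModel_apply]
  rw [← Finset.sum_filter]
  have hfil : (Finset.range N).filter (fun p => p ≤ γ.length) = Finset.range (γ.length + 1) := by
    ext p
    simp only [Finset.mem_filter, Finset.mem_range]
    omega
  have hs := congrFun (invCoeff_mul g.one) γ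
  rw [seriesMul] at hs
  rw [hfil, ← Finset.sum_mul, ← Finset.sum_div]
  have hs' := congrArg (fun r : ℝ => (r : ℂ)) hs
  simp only [Complex.ofReal_sum, Complex.ofReal_mul] at hs'
  rw [hs', seriesOne]
  split_ifs with h
  · rw [h, g.one]
    simp
  · simp

open Classical in
-- Each coordinate of the partial sums is eventually constant, so any limit must be the vacuum
-- projection.
theorem limit_defectPartialSum_universalModel_apply {D : Fock n ℂ →L[ℂ] Fock n ℂ}
    (hD : Tendsto (defectPartialSum g (universalModel g)) atTop (𝓝 D)) (f : Fock n ℂ)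
    (γ : FreeMonoid (Fin n)) : D f γ = if γ = 1 then f γ else 0 := by
  have h1 : Tendsto (fun N => defectPartialSum g (universalModel g) N f γ) atTop (𝓝 (D f γ)) := by
    simp only [← inner_single_one γ]
    exact tendsto_const_nhds.inner (((ContinuousLinearMap.apply ℂ _ f).continuous.tendsto D).comp hD)
  refine tendsto_nhds_unique h1 (tendsto_const_nhds.congr' ?_)
  filter_upwards [eventually_gt_atTop γ.length] with N hN
  exact (defectPartialSum_universalModel_apply g f hN).symm

end Coordinates

end NCDomain

/-! ### Tuples with the algebraic relations of the universal model -/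

namespace NCDomain

/-- The relations between the weighted left creation operators `W_i` and the defect operator
`Δ_{g⁻¹}(W, W*)`, the projection onto the vacuum vector, that pass to representations. -/
structure IsModelTuple {n : ℕ} (g : WeightSeries n) {H : Type*} [NormedAddCommGroup H]
    [InnerProductSpace ℂ H] [CompleteSpace H] (V : Fin n → H →L[ℂ] H) : Prop where
  hasDefect : HasDefect g V (defect g V)
  isStarProjection : IsStarProjection (defect g V)
  star_mul_defect : ∀ i, star (V i) * defect g V = 0
  star_word_mul_word : ∀ α β : FreeMonoid (Fin n), α.length = β.length → α ≠ β →
    star (word V α) * word V β = 0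
  star_mul_self_mul : ∀ i α, star (V i) * V i * (word V α * defect g V) =
    (g.coeff α / g.coeff (FreeMonoid.of i * α) : ℂ) • (word V α * defect g V)

/-! ### Relations between the universal model and the vacuum projection. -/

section Vacuum

variable {n : ℕ} (g : WeightSeries n) {D : Fock n ℂ →L[ℂ] Fock n ℂ}

open Classical in
theorem isStarProjection_of_apply (hD : ∀ (f : Fock n ℂ) γ, D f γ = if γ = 1 then f γ else 0) :
    IsStarProjection D where
  isIdempotentElem := by
    ext f γ
    rw [mul_apply_eq_comp, hD, hD]
    split_ifs <;> rfl
  isSelfAdjoint := by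
    rw [ContinuousLinearMap.isSelfAdjoint_iff_isSymmetric]
    intro x y
    change inner ℂ (D x) y = inner ℂ x (D y)
    rw [lp.inner_eq_tsum, lp.inner_eq_tsum]
    refine tsum_congr fun γ => ?_
    rw [hD, hD]
    split_ifs <;> simp

open Classical in
theorem star_universalModel_mul_vacuum
    (hD : ∀ (f : Fock n ℂ) γ, D f γ = if γ = 1 then f γ else 0) (i : Fin n) :
    star (universalModel g i) * D = 0 := by
  ext f γ
  rw [mul_apply_eq_comp, star_universalModel_apply, hD, if_neg, mul_zero]
  · rfl
  · intro h
    simpa [FreeMonoid.length_mul] using congrArg FreeMonoid.length h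

theorem star_word_universalModel_mul_word {α β : FreeMonoid (Fin n)} (hl : α.length = β.length)
    (hne : α ≠ β) : star (word (universalModel g) α) * word (universalModel g) β = 0 := by
  ext f γ
  rw [mul_apply_eq_comp, star_word_universalModel_apply, word_universalModel_apply_of_not_exists,
    mul_zero]
  · rfl
  · rintro ⟨δ, h⟩
    exact hne (List.append_inj_left h hl.symm).symm

open Classical in
-- `W_i* W_i` is diagonal but in general not scalar; it acts as a scalar here because the range of
-- `W_α P` lies on the line spanned by `e_α`.
theorem star_universalModel_mul_self_mul
    (hD : ∀ (f : Fock n ℂ) γ, D f γ = if γ = 1 then f γ else 0) (i : Fin n)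
    (α : FreeMonoid (Fin n)) :
    star (universalModel g i) * universalModel g i * (word (universalModel g) α * D) =
      (g.coeff α / g.coeff (FreeMonoid.of i * α) : ℂ) • (word (universalModel g) α * D) := by
  ext f γ
  rw [mul_apply_eq_comp, mul_apply_eq_comp, star_universalModel_apply, universalModel_apply_cons,
    ← mul_assoc, g.sqrt_mul_self, smul_apply, lp.coeFn_smul, Pi.smul_apply, smul_eq_mul,
    mul_apply_eq_comp]
  by_cases hγ : ∃ β, α * β = γ
  · obtain ⟨β, rfl⟩ := hγ
    rw [word_universalModel_apply_mul, hD]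
    split_ifs with h
    · rw [h, mul_one]
    · simp only [mul_zero]
  · rw [word_universalModel_apply_of_not_exists g α _ hγ, mul_zero, mul_zero]

end Vacuum

/-- The norm limit of the defect series belongs to `C*(W)`, and a representation is norm continuous,
so the limit and all the relations involving it can be transported by `π`. -/
theorem isModelTuple_repTuple {n : ℕ} (g : WeightSeries n)
    (hconv : ∃ D : Fock n ℂ →L[ℂ] Fock n ℂ,
      Tendsto (defectPartialSum g (universalModel g)) atTop (𝓝 D))
    {K : Type*} [NormedAddCommGroup K] [InnerProductSpace ℂ K] [CompleteSpace K]
    (π : cstarModel g →⋆ₐ[ℂ] (K →L[ℂ] K)) : IsModelTuple g (repTuple g π) := by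
  classical
  obtain ⟨D, hD⟩ := hconv
  have hcoord := limit_defectPartialSum_universalModel_apply g hD
  have hcl : IsClosed (cstarModel g : Set (Fock n ℂ →L[ℂ] Fock n ℂ)) :=
    StarSubalgebra.isClosed_topologicalClosure _
  let w : Fin n → cstarModel g := fun i => ⟨universalModel g i, universalModel_mem g i⟩
  let S : ℕ → cstarModel g := fun N => ∑ p ∈ Finset.range N, ∑ α ∈ words n p,
    (invCoeff g.coeff α : ℂ) • (word w α * star (word w α))
  have hsub : ∀ α, (cstarModel g).subtype (word w α) = word (universalModel g) α :=
    fun α => map_word (cstarModel g).subtype w α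
  have hpi : ∀ α, π (word w α) = word (repTuple g π) α := fun α => map_word π w α
  have hS : ∀ N, (cstarModel g).subtype (S N) = defectPartialSum g (universalModel g) N := by
    intro N
    simp only [S, map_sum, map_smul, map_mul, map_star, hsub, defectPartialSum]
  have hpS : ∀ N, π (S N) = defectPartialSum g (repTuple g π) N := by
    intro N
    simp only [S, map_sum, map_smul, map_mul, map_star, hpi, defectPartialSum]
  have hmem : D ∈ cstarModel g := by
    refine hcl.mem_of_tendsto hD (Eventually.of_forall fun N => ?_)
    rw [← hS N]
    exact (S N).2
  -- The vacuum projection as an element of `C*(W)`; its image under `π` will be the defect of the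
  -- represented tuple.
  let d : cstarModel g := ⟨D, hmem⟩
  have hSd : Tendsto S atTop (𝓝 d) := by
    rw [tendsto_subtype_rng]
    exact hD.congr fun N => (hS N).symm
  -- A *-homomorphism between C*-algebras is contractive.
  have hπ : Continuous π := by
    let _ : CStarAlgebra (cstarModel g) := StarSubalgebra.cstarAlgebra (cstarModel g)
    exact AddMonoidHomClass.continuous_of_bound π 1 fun a => by
      simpa only [one_mul] using NonUnitalStarAlgHom.norm_apply_le π a
  have hdef : HasDefect g (repTuple g π) (π d) := by
    have h1 : Tendsto (fun N => π (S N)) atTop (𝓝 (π d)) := (hπ.tendsto d).comp hSd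
    simp only [hpS] at h1
    exact (ContinuousLinearMapWOT.continuous_ofCLM.tendsto _).comp h1
  have hp := isStarProjection_of_apply hcoord
  have hd : IsStarProjection d :=
    ⟨Subtype.ext hp.isIdempotentElem, Subtype.ext hp.isSelfAdjoint⟩
  constructor
  all_goals try rw [hdef.defect_eq]
  · exact hdef
  · exact hd.map π
  · intro i
    have h : star (w i) * d = 0 := Subtype.ext (star_universalModel_mul_vacuum g hcoord i)
    have h' := congrArg π h
    rwa [map_mul, map_star, map_zero] at h'
  · intro α β hl hne
    have h : star (word w α) * word w β = 0 := by
      refine Subtype.ext ?_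
      have h0 := star_word_universalModel_mul_word g hl hne
      rw [← hsub α, ← hsub β] at h0
      exact h0
    have h' := congrArg π h
    rwa [map_mul, map_star, map_zero, hpi, hpi] at h'
  · intro i α
    have h : star (w i) * w i * (word w α * d) =
        (g.coeff α / g.coeff (FreeMonoid.of i * α) : ℂ) • (word w α * d) := by
      refine Subtype.ext ?_
      have h0 := star_universalModel_mul_self_mul g hcoord i α
      rw [← hsub α] at h0
      exact h0
    have h' := congrArg π h
    rw [map_smul, map_mul, map_mul, map_star, map_mul, hpi] at h'
    exact h'

end NCDomain

/-! ### Restriction of tuples to reducing subspaces -/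

namespace NCDomain

section Compression

variable {K : Type*} [NormedAddCommGroup K] [InnerProductSpace ℂ K] {M : Submodule ℂ K}
  [CompleteSpace M]

/-- The compression of an operator to a closed subspace. -/
noncomputable def compression (M : Submodule ℂ K) [CompleteSpace M] (T : K →L[ℂ] K) : M →L[ℂ] M :=
  M.orthogonalProjectionOnto ∘L T ∘L M.subtypeL

theorem inner_compression (T : K →L[ℂ] K) (x y : M) :
    inner ℂ x (compression M T y) = inner ℂ (x : K) (T y) :=
  Submodule.inner_orthogonalProjectionOnto_eq_of_mem_left x _

theorem coe_compression_of_mem {T : K →L[ℂ] K} {x : M} (h : T x ∈ M) :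
    (compression M T x : K) = T x :=
  Submodule.starProjection_eq_self_iff.2 h

theorem compression_one : compression M (1 : K →L[ℂ] K) = 1 := by
  ext x
  refine congrArg _ (ext_inner_left ℂ fun y => ?_)
  rw [inner_compression]
  rfl

theorem compression_mono {S T : K →L[ℂ] K} (h : S ≤ T) : compression M S ≤ compression M T := by
  rw [ContinuousLinearMap.le_def] at h ⊢
  have hc : compression M T - compression M S = compression M (T - S) := by
    ext x
    simp [compression]
  rw [hc]
  exact h.orthogonalProjectionOnto_comp M

end Compression

/-- The defining sum of the Berezin transform, tested against pairs of vectors. -/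
theorem hasBerezinSum_iff {n : ℕ} {g : WeightSeries n} {H : Type*} [NormedAddCommGroup H]
    [InnerProductSpace ℂ H] [CompleteSpace H] {X : Fin n → H →L[ℂ] H} {S : H →L[ℂ] H} :
    HasBerezinSum g X S ↔ ∀ x y, HasSum
      (fun α => (g.coeff α : ℂ) * inner ℂ y (word X α (defect g X (star (word X α) x))))
      (inner ℂ y (S x)) := by
  rw [HasBerezinSum, HasSum, ContinuousLinearMapWOT.tendsto_iff_forall_inner_apply_tendsto]
  refine forall₂_congr fun x y => tendsto_congr fun s => ?_
  induction s using Finset.cons_induction with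
  | empty => simp
  | cons a s ha ih =>
    rw [Finset.sum_cons, Finset.sum_cons, ContinuousLinearMapWOT.add_apply, inner_add_right, ih,
      ContinuousLinearMapWOT.ofCLM_apply, smul_apply, inner_smul_right, mul_apply_eq_comp,
      mul_apply_eq_comp]

section Restrict

variable {n : ℕ} {K : Type*} [NormedAddCommGroup K] [InnerProductSpace ℂ K] [CompleteSpace K]

theorem Reduces.one (M : Submodule ℂ K) : Reduces M (1 : K →L[ℂ] K) :=
  ⟨fun _ hx => hx, fun _ hx => by rw [star_one]; exact hx⟩

theorem Reduces.mul {M : Submodule ℂ K} {S T : K →L[ℂ] K} (hS : Reduces M S) (hT : Reduces M T) :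
    Reduces M (S * T) :=
  ⟨fun x hx => hS.1 _ (hT.1 x hx), fun x hx => by rw [star_mul]; exact hT.2 _ (hS.2 x hx)⟩

theorem Reduces.word {M : Submodule ℂ K} {V : Fin n → K →L[ℂ] K} (hM : ∀ i, Reduces M (V i))
    (α : FreeMonoid (Fin n)) : Reduces M (word V α) := by
  induction α using FreeMonoid.inductionOn' with
  | one => exact word_one V ▸ Reduces.one M
  | of_mul i α ih => exact word_mul V _ _ ▸ (word_of V i ▸ hM i).mul ih

theorem Reduces.orthogonal {M : Submodule ℂ K} {T : K →L[ℂ] K} (hM : Reduces M T) :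
    Reduces Mᗮ T := by
  refine ⟨fun x hx => ?_, fun x hx => ?_⟩ <;> rw [Submodule.mem_orthogonal] at hx ⊢ <;> intro y hy
  · rw [← ContinuousLinearMap.adjoint_inner_left]
    exact hx _ (hM.2 y hy)
  · rw [ContinuousLinearMap.star_eq_adjoint, ContinuousLinearMap.adjoint_inner_right]
    exact hx _ (hM.1 y hy)

variable {V : Fin n → K →L[ℂ] K} {M : Submodule ℂ K} (hM : ∀ i, Reduces M (V i))

theorem coe_word_restrictTuple (α : FreeMonoid (Fin n)) (x : M) :
    (word (restrictTuple V M hM) α x : K) = word V α x := by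
  induction α using FreeMonoid.inductionOn' with
  | one => rw [word_one, word_one]; rfl
  | of_mul i α ih =>
    rw [word_mul, word_mul, word_of, word_of, mul_apply_eq_comp, mul_apply_eq_comp, ← ih]
    rfl

variable [CompleteSpace M]

theorem coe_star_word_restrictTuple (α : FreeMonoid (Fin n)) (x : M) :
    (star (word (restrictTuple V M hM) α) x : K) = star (word V α) x := by
  have hx : star (word V α) x ∈ M := (Reduces.word hM α).2 x x.2
  suffices h : star (word (restrictTuple V M hM) α) x = ⟨star (word V α) x, hx⟩ by rw [h]
  refine ext_inner_left ℂ fun y => ?_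
  rw [ContinuousLinearMap.star_eq_adjoint, ContinuousLinearMap.adjoint_inner_right,
    Submodule.coe_inner, Submodule.coe_inner, coe_word_restrictTuple]
  exact (ContinuousLinearMap.adjoint_inner_right (word V α) (y : K) (x : K)).symm

theorem inner_defectPartialSum_restrictTuple (g : WeightSeries n) (N : ℕ) (x y : M) :
    inner ℂ x (defectPartialSum g (restrictTuple V M hM) N y) =
      inner ℂ (x : K) (defectPartialSum g V N y) := by
  simp only [defectPartialSum, sum_apply, smul_apply, inner_sum, inner_smul_right,
    mul_apply_eq_comp, Submodule.coe_inner, coe_word_restrictTuple, coe_star_word_restrictTuple]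

theorem HasDefect.restrictTuple {g : WeightSeries n} {D : K →L[ℂ] K} (h : HasDefect g V D) :
    HasDefect g (restrictTuple V M hM) (compression M D) := by
  rw [HasDefect, ContinuousLinearMapWOT.tendsto_iff_forall_inner_apply_tendsto]
  intro x y
  change Tendsto (fun N => inner ℂ y (defectPartialSum g (NCDomain.restrictTuple V M hM) N x))
    atTop (𝓝 (inner ℂ y (compression M D x)))
  simp only [inner_defectPartialSum_restrictTuple, inner_compression]
  exact ContinuousLinearMapWOT.tendsto_iff_forall_inner_apply_tendsto.1 h x y

/-- The partial sums map `M` into itself, and `M = Mᗮᗮ` is weakly closed, so the weak limit does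
too; self-adjointness takes care of the adjoint. -/
theorem HasDefect.reduces {M : Submodule ℂ K} [CompleteSpace M]
    (hM : ∀ i, Reduces M (V i)) {g : WeightSeries n} {D : K →L[ℂ] K} (h : HasDefect g V D)
    (hD : IsSelfAdjoint D) : Reduces M D := by
  suffices h0 : ∀ x ∈ M, D x ∈ M from ⟨h0, by rwa [hD.star_eq]⟩
  intro x hx
  rw [← Submodule.orthogonal_orthogonal M, Submodule.mem_orthogonal]
  intro y hy
  have h1 := ContinuousLinearMapWOT.tendsto_iff_forall_inner_apply_tendsto.1 h x y
  refine tendsto_nhds_unique h1 (tendsto_const_nhds.congr fun N => ?_)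
  refine (Submodule.inner_left_of_mem_orthogonal ?_ hy).symm
  change defectPartialSum g V N x ∈ M
  simp only [defectPartialSum, sum_apply, smul_apply, mul_apply_eq_comp]
  exact M.sum_mem fun p _ => M.sum_mem fun α _ => M.smul_mem _
    ((Reduces.word hM α).1 _ ((Reduces.word hM α).2 x hx))

/-- The defect of the restriction is the compression of `Δ`, and `Δ` leaves `M` invariant, so tested
on vectors of `M` the two series agree term by term. The sum `S` itself need not preserve `M`. -/
theorem HasBerezinSum.restrictTuple {g : WeightSeries n} {S : K →L[ℂ] K}
    (hD : HasDefect g V (defect g V)) (hDs : IsSelfAdjoint (defect g V))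
    (h : HasBerezinSum g V S) :
    HasBerezinSum g (restrictTuple V M hM) (compression M S) := by
  have hdef := hD.restrictTuple hM
  have hred := HasDefect.reduces hM hD hDs
  rw [hasBerezinSum_iff] at h ⊢
  intro x y
  rw [inner_compression]
  convert! h x y using 3 with α
  rw [hdef.defect_eq, Submodule.coe_inner, coe_word_restrictTuple, coe_compression_of_mem,
    coe_star_word_restrictTuple]
  exact hred.1 _ (Subtype.coe_prop _)

theorem InDomain.restrictTuple {g : WeightSeries n} (h : InDomain g V) :
    InDomain g (restrictTuple V M hM) := by
  have hdef := h.hasDefect.restrictTuple hM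
  refine ⟨hdef.defect_eq ▸ hdef, ?_, ?_⟩
  · rw [hdef.defect_eq]
    have h0 := compression_mono (M := M) h.defect_nonneg
    have h1 : compression M (0 : K →L[ℂ] K) = 0 := by ext; simp [compression]
    rwa [h1] at h0
  · obtain ⟨S, hS, hS1⟩ := h.sum_le_one
    exact ⟨compression M S, hS.restrictTuple hM h.hasDefect h.defect_nonneg.isSelfAdjoint,
      compression_one (M := M) ▸ compression_mono hS1⟩

end Restrict

end NCDomain

/-! ### The Wold isometry of a model tuple -/

namespace NCDomain

namespace IsModelTuple

/-! ### Orthogonality of the subspaces `V_α 𝒟`. -/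

section

variable {n : ℕ} {g : WeightSeries n} {K : Type*} [NormedAddCommGroup K] [InnerProductSpace ℂ K]
  [CompleteSpace K] {V : Fin n → K →L[ℂ] K} (hV : IsModelTuple g V)

include hV

theorem star_mul_of_ne {i j : Fin n} (hij : i ≠ j) : star (V i) * V j = 0 := by
  have h := hV.star_word_mul_word (FreeMonoid.of i) (FreeMonoid.of j) rfl
    fun h => hij (FreeMonoid.of_injective h)
  rwa [word_of, word_of] at h

/-- The first letter is peeled off: the innermost `V_i* V_i` acts on `V_α Δ` as the scalar `b_α /
b_{g_i α}`, and these ratios telescope. -/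
theorem star_word_mul_word_mul_defect_self (α : FreeMonoid (Fin n)) :
    star (word V α) * (word V α * defect g V) = (g.coeff α : ℂ)⁻¹ • defect g V := by
  induction α using FreeMonoid.inductionOn' with
  | one => simp [word_one, g.one]
  | of_mul i α ih =>
    have h : star (V i * word V α) * (V i * word V α * defect g V) =
        star (word V α) * (star (V i) * V i * (word V α * defect g V)) := by
      simp only [star_mul, mul_assoc]
    rw [word_mul, word_of, h, hV.star_mul_self_mul, mul_smul_comm, ih, smul_smul]
    have := g.ne_zero α
    congr 1
    field_simp

/-- Common first letters cancel up to scalars. Then either two different letters meet and `V_i* V_j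
= 0`, or `β` is exhausted first and `V_i* Δ = 0`. The length bound excludes that `α` runs out first,
when the product need not vanish. -/
theorem star_word_mul_word_mul_defect_of_ne {α β : FreeMonoid (Fin n)}
    (hl : β.length ≤ α.length) (hne : α ≠ β) :
    star (word V α) * (word V β * defect g V) = 0 := by
  induction α using FreeMonoid.inductionOn' generalizing β with
  | one => exact absurd (FreeMonoid.length_eq_zero.1 (Nat.le_zero.1 hl)).symm hne
  | of_mul i α ih =>
    rw [word_mul, word_of]
    induction β using FreeMonoid.inductionOn' with
    | one => rw [word_one, one_mul, star_mul, mul_assoc, hV.star_mul_defect, mul_zero]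
    | of_mul j β _ =>
      have h : star (V i * word V α) * (V j * word V β * defect g V) =
          star (word V α) * (star (V i) * V j * (word V β * defect g V)) := by
        simp only [star_mul, mul_assoc]
      rw [word_mul, word_of, h]
      by_cases hij : i = j
      · subst hij
        rw [hV.star_mul_self_mul, mul_smul_comm, ih, smul_zero]
        · simpa [FreeMonoid.length_mul] using hl
        · exact fun h => hne (h ▸ rfl)
      · rw [hV.star_mul_of_ne hij, zero_mul, mul_zero]

theorem defect_defect (x : K) : defect g V (defect g V x) = defect g V x :=
  DFunLike.congr_fun hV.isStarProjection.isIdempotentElem x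

theorem inner_defect_left (x y : K) : inner ℂ (defect g V x) y = inner ℂ x (defect g V y) := by
  rw [← ContinuousLinearMap.adjoint_inner_right, ← ContinuousLinearMap.star_eq_adjoint,
    hV.isStarProjection.isSelfAdjoint.star_eq]

/-- The range of an idempotent is its set of fixed points, hence closed. -/
theorem range_defect : LinearMap.range (defect g V).toLinearMap = defectSpace g V := by
  refine le_antisymm (Submodule.le_topologicalClosure _) ?_
  refine Submodule.topologicalClosure_minimal _ le_rfl ?_
  have h : ((LinearMap.range (defect g V).toLinearMap : Submodule ℂ K) : Set K) =
      {x | defect g V x = x} := by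
    ext x
    refine ⟨?_, fun h => ⟨x, h⟩⟩
    rintro ⟨y, rfl⟩
    exact hV.defect_defect y
  rw [h]
  exact isClosed_eq (defect g V).continuous continuous_id

theorem defect_coe (x : defectSpace g V) : defect g V x = x := by
  obtain ⟨y, hy⟩ := hV.range_defect.ge x.2
  rw [← hy]
  exact hV.defect_defect y

theorem star_word_word_self (α : FreeMonoid (Fin n)) (x : defectSpace g V) :
    star (word V α) (word V α x) = (g.coeff α : ℂ)⁻¹ • (x : K) := by
  have h := DFunLike.congr_fun (hV.star_word_mul_word_mul_defect_self α) (x : K)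
  simpa only [mul_apply_eq_comp, smul_apply, hV.defect_coe] using h

theorem star_word_word_of_ne {α β : FreeMonoid (Fin n)} (hl : β.length ≤ α.length) (hne : α ≠ β)
    (x : defectSpace g V) : star (word V α) (word V β x) = 0 := by
  have h := DFunLike.congr_fun (hV.star_word_mul_word_mul_defect_of_ne hl hne) (x : K)
  simpa only [mul_apply_eq_comp, hV.defect_coe, zero_apply] using h

theorem norm_sqrt_smul_word (α : FreeMonoid (Fin n)) (x : defectSpace g V) :
    ‖((√(g.coeff α) : ℝ) : ℂ) • word V α x‖ = ‖x‖ := by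
  have h1 : inner ℂ (word V α (x : K)) (word V α (x : K)) =
      (g.coeff α : ℂ)⁻¹ * inner ℂ (x : K) (x : K) := by
    rw [← ContinuousLinearMap.adjoint_inner_right, ← ContinuousLinearMap.star_eq_adjoint,
      hV.star_word_word_self, inner_smul_right]
  rw [inner_self_eq_norm_sq_to_K, inner_self_eq_norm_sq_to_K] at h1
  have h2 : ‖word V α (x : K)‖ ^ 2 = (g.coeff α)⁻¹ * ‖x‖ ^ 2 := by
    apply Complex.ofReal_injective
    push_cast
    exact h1
  rw [← sq_eq_sq₀ (norm_nonneg _) (norm_nonneg _), norm_smul, mul_pow, Complex.norm_real,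
    Real.norm_eq_abs, sq_abs, Real.sq_sqrt (g.pos α).le, h2, mul_inv_cancel_left₀ (g.pos α).ne']

end

/-! ### The isometry from Fock space and its adjoint, the Berezin kernel. -/

section Isometry

variable {n : ℕ} {g : WeightSeries n} {K : Type*} [NormedAddCommGroup K] [InnerProductSpace ℂ K]
  [CompleteSpace K] {V : Fin n → K →L[ℂ] K} (hV : IsModelTuple g V)

include hV

/-- The isometry `x ↦ √b_α V_α x` of the defect space. -/
noncomputable def embedding (α : FreeMonoid (Fin n)) : defectSpace g V →ₗᵢ[ℂ] K where
  toLinearMap := ((√(g.coeff α) : ℝ) : ℂ) • (word V α).toLinearMap ∘ₗ (defectSpace g V).subtype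
  norm_map' := hV.norm_sqrt_smul_word α

theorem embedding_apply (α : FreeMonoid (Fin n)) (x : defectSpace g V) :
    hV.embedding α x = ((√(g.coeff α) : ℝ) : ℂ) • word V α x := rfl

theorem orthogonalFamily_embedding :
    OrthogonalFamily ℂ (fun _ : FreeMonoid (Fin n) => defectSpace g V) hV.embedding := by
  -- The vanishing relation needs the longer word on the starred side; the other case follows by
  -- conjugate symmetry.
  have key : ∀ α β : FreeMonoid (Fin n), β.length ≤ α.length → α ≠ β →
      ∀ x y : defectSpace g V, inner ℂ (hV.embedding α x) (hV.embedding β y) = 0 := by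
    intro α β hl hne x y
    rw [embedding_apply, embedding_apply, inner_smul_left, inner_smul_right,
      ← ContinuousLinearMap.adjoint_inner_right, ← ContinuousLinearMap.star_eq_adjoint,
      hV.star_word_word_of_ne hl hne, inner_zero_right, mul_zero, mul_zero]
  intro α β hne x y
  rcases le_total β.length α.length with h | h
  · exact key α β h hne x y
  · rw [← inner_conj_symm, key β α h hne.symm y x, map_zero]

/-- The isometry `F²(Hₙ) ⊗ 𝒟 → K`, `e_α ⊗ x ↦ √b_α V_α x`, whose adjoint is the Berezin
kernel. -/
noncomputable def woldIsometry : Fock n (defectSpace g V) →ₗᵢ[ℂ] K :=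
  hV.orthogonalFamily_embedding.linearIsometry

theorem hasSum_woldIsometry (f : Fock n (defectSpace g V)) :
    HasSum (fun α => ((√(g.coeff α) : ℝ) : ℂ) • word V α (f α)) (hV.woldIsometry f) :=
  hV.orthogonalFamily_embedding.hasSum_linearIsometry f

open Classical in
theorem woldIsometry_single (α : FreeMonoid (Fin n)) (x : defectSpace g V) :
    hV.woldIsometry (lp.single 2 α x) = ((√(g.coeff α) : ℝ) : ℂ) • word V α x :=
  hV.orthogonalFamily_embedding.linearIsometry_apply_single x

/-- The adjoint of the Wold isometry. -/
noncomputable abbrev woldAdjoint : K →L[ℂ] Fock n (defectSpace g V) :=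
  ContinuousLinearMap.adjoint hV.woldIsometry.toContinuousLinearMap

theorem woldAdjoint_apply (h : K) (α : FreeMonoid (Fin n)) :
    (hV.woldAdjoint h α : K) =
      ((√(g.coeff α) : ℝ) : ℂ) • defect g V (star (word V α) h) := by
  classical
  suffices h0 : hV.woldAdjoint h α = ((√(g.coeff α) : ℝ) : ℂ) •
      (⟨defect g V (star (word V α) h), hV.range_defect.le ⟨_, rfl⟩⟩ : defectSpace g V) by rw [h0]; rfl
  refine ext_inner_left ℂ fun x => ?_
  -- The coordinate at `α` is read off by pairing with `e_α ⊗ x`, which the isometry sends to `√b_α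
  -- V_α x`.
  refine (lp.inner_single_left (𝕜 := ℂ) α x (hV.woldAdjoint h)).symm.trans ?_
  rw [ContinuousLinearMap.adjoint_inner_right,
    LinearIsometry.coe_toContinuousLinearMap, woldIsometry_single, inner_smul_left,
    inner_smul_right, Complex.conj_ofReal, Submodule.coe_inner, ← hV.inner_defect_left,
    hV.defect_coe, ContinuousLinearMap.star_eq_adjoint, ContinuousLinearMap.adjoint_inner_right]

theorem woldAdjoint_woldIsometry (f : Fock n (defectSpace g V)) :
    hV.woldAdjoint (hV.woldIsometry f) = f := by
  refine ext_inner_left ℂ fun x => ?_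
  rw [ContinuousLinearMap.adjoint_inner_right]
  exact hV.woldIsometry.inner_map_map x f

/-- The projection onto the range of the Wold isometry. -/
noncomputable def woldProjection : K →L[ℂ] K :=
  hV.woldIsometry.toContinuousLinearMap ∘L hV.woldAdjoint

theorem woldProjection_apply (x : K) :
    hV.woldProjection x = hV.woldIsometry (hV.woldAdjoint x) := rfl

theorem inner_woldProjection (x y : K) :
    inner ℂ x (hV.woldProjection y) = inner ℂ (hV.woldAdjoint x) (hV.woldAdjoint y) := by
  rw [ContinuousLinearMap.adjoint_inner_left]
  rfl

theorem isStarProjection_woldProjection : IsStarProjection hV.woldProjection where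
  isIdempotentElem := by
    ext x
    rw [mul_apply_eq_comp, woldProjection_apply, woldProjection_apply, woldAdjoint_woldIsometry]
  isSelfAdjoint := by
    rw [ContinuousLinearMap.isSelfAdjoint_iff_isSymmetric]
    intro x y
    change inner ℂ (hV.woldProjection x) y = inner ℂ x (hV.woldProjection y)
    rw [← inner_conj_symm, inner_woldProjection, inner_woldProjection, inner_conj_symm]

/-- Expanding the isometry at the image of `x` under its adjoint gives the series `∑ √b_α V_α (√b_α
Δ V_α* x)`, which is the Berezin sum and even converges in norm. -/
theorem hasBerezinSum_woldProjection : HasBerezinSum g V hV.woldProjection := by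
  rw [hasBerezinSum_iff]
  intro x y
  have h := (innerSL ℂ y).hasSum (hV.hasSum_woldIsometry (hV.woldAdjoint x))
  convert! h using 2 with α
  rw [innerSL_apply_apply, woldAdjoint_apply, map_smul, inner_smul_right, inner_smul_right, ← mul_assoc,
    ← Complex.ofReal_mul, Real.mul_self_sqrt (g.pos α).le]

theorem inDomain : InDomain g V :=
  ⟨hV.hasDefect, hV.isStarProjection.nonneg, hV.woldProjection, hV.hasBerezinSum_woldProjection,
    hV.isStarProjection_woldProjection.le_one⟩

/-- A projection is its own positive square root, so `Δ^{1/2}` may be replaced by `Δ`. -/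
theorem berezinKernel_eq (hdom : InDomain g V) : berezinKernel g V hdom = hV.woldAdjoint := by
  ext h α
  have hs : CFC.sqrt (defect g V) = defect g V :=
    CFC.sqrt_unique hV.isStarProjection.isIdempotentElem hV.isStarProjection.nonneg
  rw [berezinKernel_apply, woldAdjoint_apply, hs]

end Isometry

end IsModelTuple

end NCDomain

/-! ### The Wold decomposition of a model tuple -/

namespace NCDomain

section Orthogonality

variable {K : Type*} [NormedAddCommGroup K] [InnerProductSpace ℂ K] [CompleteSpace K]

theorem mem_orthogonal_closedRange {T : K →L[ℂ] K} {x : K} :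
    x ∈ (closedRange T)ᗮ ↔ star T x = 0 := by
  rw [closedRange, Submodule.orthogonal_closure, ContinuousLinearMap.orthogonal_range]
  rfl

theorem closedRange_isOrtho {S T : K →L[ℂ] K} (h : star T * S = 0) :
    closedRange S ⟂ closedRange T := by
  rw [Submodule.isOrtho_iff_le]
  refine Submodule.topologicalClosure_minimal _ ?_ (Submodule.isClosed_orthogonal _)
  rintro _ ⟨x, rfl⟩
  exact mem_orthogonal_closedRange.2 (DFunLike.congr_fun h x)

theorem mem_orthogonal_closure_iSup_closedRange {ι : Type*} {T : ι → K →L[ℂ] K} {x : K} :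
    x ∈ (⨆ i, closedRange (T i)).topologicalClosureᗮ ↔ ∀ i, star (T i) x = 0 := by
  rw [Submodule.orthogonal_closure, ← Submodule.iInf_orthogonal, Submodule.mem_iInf]
  exact forall_congr' fun i => mem_orthogonal_closedRange

theorem isOrthogonalSum_closedRange {ι : Type*} {T : ι → K →L[ℂ] K}
    (h : ∀ i j, i ≠ j → star (T i) * T j = 0) :
    IsOrthogonalSum (fun i => closedRange (T i))
      (⨆ i, closedRange (T i)).topologicalClosure where
  closed _ := Submodule.isClosed_topologicalClosure _
  orthogonal i j hij := closedRange_isOrtho (h j i hij.symm)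
  eq_closure := rfl

end Orthogonality

namespace IsModelTuple

variable {n : ℕ} {g : WeightSeries n} {K : Type*} [NormedAddCommGroup K] [InnerProductSpace ℂ K]
  [CompleteSpace K] {V : Fin n → K →L[ℂ] K} (hV : IsModelTuple g V)

include hV

/-- The range of the Wold isometry. -/
noncomputable abbrev purePart : Submodule ℂ K :=
  LinearMap.range hV.woldIsometry.toLinearMap

theorem isClosed_purePart : IsClosed (hV.purePart : Set K) :=
  hV.woldIsometry.isometry.isUniformInducing.isComplete_range.isClosed

theorem orthogonal_purePart : hV.purePartᗮ = LinearMap.ker hV.woldAdjoint.toLinearMap :=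
  ContinuousLinearMap.orthogonal_range hV.woldIsometry.toContinuousLinearMap

theorem mem_purePart_iff {x : K} : x ∈ hV.purePart ↔ hV.woldProjection x = x := by
  refine ⟨?_, fun h => ⟨_, h⟩⟩
  rintro ⟨f, rfl⟩
  exact congrArg hV.woldIsometry (hV.woldAdjoint_woldIsometry f)

theorem word_mem_purePart (α : FreeMonoid (Fin n)) (x : defectSpace g V) :
    word V α x ∈ hV.purePart := by
  classical
  have h : ((√(g.coeff α) : ℝ) : ℂ) • word V α (x : K) ∈ hV.purePart :=
    ⟨_, hV.woldIsometry_single α x⟩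
  refine (Submodule.smul_mem_iff _ ?_).1 h
  exact Complex.ofReal_ne_zero.2 (Real.sqrt_pos.2 (g.pos α)).ne'

theorem mem_orthogonal_purePart_iff {x : K} :
    x ∈ hV.purePartᗮ ↔ ∀ α, defect g V (star (word V α) x) = 0 := by
  rw [hV.orthogonal_purePart, LinearMap.mem_ker]
  have hne : ∀ α, ((√(g.coeff α) : ℝ) : ℂ) ≠ 0 := fun α =>
    Complex.ofReal_ne_zero.2 (Real.sqrt_pos.2 (g.pos α)).ne'
  constructor
  · intro h α
    have h1 := hV.woldAdjoint_apply x α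
    have h2 : hV.woldAdjoint x = 0 := h
    rw [h2] at h1
    exact (smul_eq_zero.1 h1.symm).resolve_left (hne α)
  · intro h
    change hV.woldAdjoint x = 0
    ext α
    rw [hV.woldAdjoint_apply, h α, smul_zero]
    rfl

/-- The normalizations match: `√b_{g_i α} √(b_α / b_{g_i α}) = √b_α`. -/
theorem apply_woldIsometry (i : Fin n) (f : Fock n (defectSpace g V)) :
    V i (hV.woldIsometry f) = hV.woldIsometry (shift (defectSpace g V) g i f) := by
  have h1 := (V i).hasSum (hV.hasSum_woldIsometry f)
  have h2 := hV.hasSum_woldIsometry (shift (defectSpace g V) g i f)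
  -- The shifted family vanishes off the words beginning with `g_i`, so its series may be indexed by
  -- the remaining tails.
  rw [← (cons_injective i).hasSum_iff] at h2
  · refine h1.unique ?_
    convert! h2 using 2 with α
    have hne := (g.pos (FreeMonoid.of i * α)).ne'
    simp only [Function.comp_apply, shift_apply, shiftFun_cons, Submodule.coe_smul, map_smul,
      smul_smul, word_mul, word_of, mul_apply_eq_comp, ← Complex.ofReal_mul,
      ← Real.sqrt_mul (g.pos _).le]
    rw [mul_div_cancel₀ _ hne]
  · intro γ hγ
    rw [shift_apply, shiftFun_of_notMem g i _ (by simpa using hγ), Submodule.coe_zero, map_zero,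
      smul_zero]

theorem reduces_purePart (i : Fin n) : Reduces hV.purePart (V i) := by
  constructor
  · rintro _ ⟨f, rfl⟩
    exact ⟨_, (hV.apply_woldIsometry i f).symm⟩
  · rintro _ ⟨f, rfl⟩
    have h := (star (V i)).hasSum (hV.hasSum_woldIsometry f)
    -- As the range is closed, it suffices to treat each `V_i* V_α x` with `x ∈ 𝒟`. It is `0` if `α`
    -- is empty or begins with another letter, and a multiple of a shorter `V_β x` if `α = g_i β`.
    refine hV.isClosed_purePart.mem_of_tendsto h (Eventually.of_forall fun s => ?_)
    refine Submodule.sum_mem _ fun α _ => ?_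
    rw [map_smul]
    refine Submodule.smul_mem _ _ ?_
    have hx := hV.defect_coe (f α)
    induction α using FreeMonoid.inductionOn' with
    | one =>
      have h0 := DFunLike.congr_fun (hV.star_mul_defect i) (f 1 : K)
      rw [mul_apply_eq_comp, hx] at h0
      rw [word_one]
      exact h0.symm ▸ Submodule.zero_mem _
    | of_mul j α _ =>
      rw [word_mul, word_of, mul_apply_eq_comp]
      by_cases hij : i = j
      · subst hij
        have h0 := DFunLike.congr_fun (hV.star_mul_self_mul i α) (f (FreeMonoid.of i * α) : K)
        simp only [mul_apply_eq_comp, smul_apply, hx] at h0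
        rw [h0]
        exact Submodule.smul_mem _ _ (hV.word_mem_purePart α _)
      · have h0 := DFunLike.congr_fun (hV.star_mul_of_ne hij)
          (word V α (f (FreeMonoid.of j * α) : K))
        rw [mul_apply_eq_comp] at h0
        rw [h0]
        exact Submodule.zero_mem _

theorem isWoldDecomposition : IsWoldDecomposition g V hV.purePart hV.purePartᗮ := by
  have hcl := hV.isClosed_purePart
  have hc : CompleteSpace hV.purePart := hcl.completeSpace_coe
  refine ⟨hcl, Submodule.isClosed_orthogonal _, Submodule.isOrtho_orthogonal_right _,
    Submodule.sup_orthogonal_of_hasOrthogonalProjection, hV.reduces_purePart,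
    fun i => (hV.reduces_purePart i).orthogonal, ⟨hV.inDomain.restrictTuple _, ?_⟩,
    ⟨hV.inDomain.restrictTuple _, ?_⟩⟩
  · have h := hV.hasBerezinSum_woldProjection.restrictTuple hV.reduces_purePart hV.hasDefect
      hV.isStarProjection.isSelfAdjoint
    have h1 : compression hV.purePart hV.woldProjection = 1 := by
      ext x
      have hx := hV.mem_purePart_iff.1 x.2
      rw [coe_compression_of_mem (hx.symm ▸ x.2), hx]
      rfl
    rwa [h1] at h
  · rw [(hV.hasDefect.restrictTuple _).defect_eq]
    ext x
    -- The empty word gives `Δ x = 0` on the complement.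
    have hx := hV.mem_orthogonal_purePart_iff.1 x.2 1
    rw [word_one, star_one] at hx
    change defect g V (x : K) = 0 at hx
    rw [coe_compression_of_mem (hx.symm ▸ Submodule.zero_mem _), hx]
    rfl

/-- Let `Q` be the projection onto the pure part. Purity says that the compression of `Q` to `M` is
the identity, so `⟨x, Q x⟩ = ⟨x, x⟩` on `M`; for a projection this forces `‖Q x - x‖² = 0`. -/
theorem le_purePart_of_isPure {M : Submodule ℂ K} [CompleteSpace M]
    (hM : ∀ i, Reduces M (V i)) (hp : IsPure g (restrictTuple V M hM)) : M ≤ hV.purePart := by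
  intro x hx
  have h := hV.hasBerezinSum_woldProjection.restrictTuple hM hV.hasDefect
    hV.isStarProjection.isSelfAdjoint
  have h1 : compression M hV.woldProjection = 1 :=
    ContinuousLinearMapWOT.ofCLM_injective (HasSum.unique h hp.2)
  have h2 := inner_compression hV.woldProjection (⟨x, hx⟩ : M) ⟨x, hx⟩
  rw [h1] at h2
  have h3 : inner ℂ x (hV.woldProjection x) = inner ℂ x x := h2.symm
  have h4 : inner ℂ (hV.woldProjection x) x = inner ℂ x x := by
    rw [← inner_conj_symm, h3, inner_conj_symm]
  have h5 : inner ℂ (hV.woldProjection x) (hV.woldProjection x) = inner ℂ x x := by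
    rw [← h3, inner_woldProjection, inner_woldProjection, woldProjection_apply,
      woldAdjoint_woldIsometry]
  rw [hV.mem_purePart_iff, ← sub_eq_zero, ← inner_self_eq_zero (𝕜 := ℂ), inner_sub_left,
    inner_sub_right, inner_sub_right, h3, h4, h5]
  ring

/-- `Δ` vanishes on `N`, and `N` is invariant under every `V_α*`, so all `Δ V_α* x` vanish. -/
theorem le_orthogonal_purePart_of_isCuntz {N : Submodule ℂ K} [CompleteSpace N]
    (hN : ∀ i, Reduces N (V i)) (hc : IsCuntz g (restrictTuple V N hN)) :
    N ≤ hV.purePartᗮ := by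
  have hred := hV.hasDefect.reduces hN hV.isStarProjection.isSelfAdjoint
  have h0 : ∀ x ∈ N, defect g V x = 0 := by
    intro x hx
    have h1 := (hV.hasDefect.restrictTuple hN).defect_eq.symm.trans hc.2
    rw [← coe_compression_of_mem (x := (⟨x, hx⟩ : N)) (hred.1 x hx), h1]
    rfl
  intro x hx
  rw [hV.mem_orthogonal_purePart_iff]
  exact fun α => h0 _ ((Reduces.word hN α).2 x hx)

/-- The two inclusions already suffice: summands contained in the respective terms of a direct sum,
and together spanning `K`, must be equal to them. -/
theorem eq_of_isWoldDecomposition {M N : Submodule ℂ K} (h : IsWoldDecomposition g V M N) :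
    M = hV.purePart ∧ N = hV.purePartᗮ := by
  have hcM : CompleteSpace M := h.closed_left.completeSpace_coe
  have hcN : CompleteSpace N := h.closed_right.completeSpace_coe
  have hM := hV.le_purePart_of_isPure h.reduces_left h.pure_left
  have hN := hV.le_orthogonal_purePart_of_isCuntz h.reduces_right h.cuntz_right
  have hd : Disjoint hV.purePart hV.purePartᗮ := Submodule.orthogonal_disjoint _
  constructor
  · refine le_antisymm hM fun x hx => ?_
    obtain ⟨y, hy, z, hz, rfl⟩ := Submodule.mem_sup.1 (h.sup_eq_top.ge (Submodule.mem_top (x := x)))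
    have hz0 : z ∈ hV.purePart := by
      simpa using Submodule.sub_mem _ hx (hM hy)
    rw [Submodule.disjoint_def.1 hd z hz0 (hN hz), add_zero]
    exact hy
  · refine le_antisymm hN fun x hx => ?_
    obtain ⟨y, hy, z, hz, rfl⟩ := Submodule.mem_sup.1 (h.sup_eq_top.ge (Submodule.mem_top (x := x)))
    have hy0 : y ∈ hV.purePartᗮ := by
      simpa using Submodule.sub_mem _ hx (hN hz)
    rw [Submodule.disjoint_def.1 hd y (hM hy) hy0, zero_add]
    exact hz

/-! ### Descriptions of the summands by wandering subspaces and ranges. -/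

theorem range_embedding (α : FreeMonoid (Fin n)) :
    LinearMap.range (hV.embedding α).toLinearMap =
      (LinearMap.range (defect g V).toLinearMap).map (word V α).toLinearMap := by
  have hne : ((√(g.coeff α) : ℝ) : ℂ) ≠ 0 :=
    Complex.ofReal_ne_zero.2 (Real.sqrt_pos.2 (g.pos α)).ne'
  rw [hV.range_defect]
  ext x
  constructor
  · rintro ⟨y, rfl⟩
    exact Submodule.smul_mem _ _ ⟨y, y.2, rfl⟩
  · rintro ⟨y, hy, rfl⟩
    refine ⟨(((√(g.coeff α) : ℝ) : ℂ)⁻¹ • ⟨y, hy⟩ : defectSpace g V), ?_⟩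
    change hV.embedding α _ = word V α y
    rw [map_smul, embedding_apply, inv_smul_smul₀ hne]

theorem isOrthogonalSum_purePart :
    IsOrthogonalSum (fun α : FreeMonoid (Fin n) =>
      (LinearMap.range (defect g V).toLinearMap).map (word V α).toLinearMap) hV.purePart := by
  simp only [← hV.range_embedding]
  refine ⟨fun α => ?_, fun α β hne => ?_, hV.orthogonalFamily_embedding.range_linearIsometry⟩
  · exact (hV.embedding α).isometry.isUniformInducing.isComplete_range.isClosed
  · refine Submodule.isOrtho_iff_inner_eq.2 ?_
    rintro _ ⟨x, rfl⟩ _ ⟨y, rfl⟩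
    exact hV.orthogonalFamily_embedding hne x y

/-- Every term of the defect series with a nonempty word kills `x`, and the empty word has
coefficient `1`. -/
theorem defect_eq_self {x : K} (hx : ∀ i, star (V i) x = 0) : defect g V x = x := by
  have hw : ∀ α ≠ 1, star (word V α) x = 0 := by
    intro α hα
    induction α using FreeMonoid.inductionOn' with
    | one => exact absurd rfl hα
    | of_mul i α _ =>
      rw [word_mul, word_of, star_mul, mul_apply_eq_comp, hx i, map_zero]
  -- The index `N + 1` ensures that the degree `0` term is present; the empty partial sum would be
  -- `0`.
  have hp : ∀ N, defectPartialSum g V (N + 1) x = x := by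
    intro N
    rw [defectPartialSum, sum_apply, Finset.sum_range_succ', Finset.sum_eq_zero, zero_add,
      sum_apply, Finset.sum_eq_single 1]
    · have h1 : invCoeff g.coeff 1 = 1 := by rw [invCoeff, if_pos rfl]
      simp [h1, word_one]
    · intro α _ hα
      rw [smul_apply, mul_apply_eq_comp, hw α hα, map_zero, smul_zero]
    · exact fun h => absurd (mem_words.2 FreeMonoid.length_one) h
    · intro p _
      rw [sum_apply]
      refine Finset.sum_eq_zero fun α hα => ?_
      have hα1 : α ≠ 1 := by
        rintro rfl
        exact absurd (mem_words.1 hα) (Nat.succ_ne_zero p).symm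
      rw [smul_apply, mul_apply_eq_comp, hw α hα1, map_zero, smul_zero]
  refine ext_inner_left ℂ fun y => ?_
  have h := ContinuousLinearMapWOT.tendsto_iff_forall_inner_apply_tendsto.1 hV.hasDefect x y
  refine tendsto_nhds_unique (h.comp (tendsto_add_atTop_nat 1)) ?_
  refine tendsto_const_nhds.congr fun N => ?_
  exact congrArg (inner ℂ y) (hp N).symm

theorem range_defect_eq_orthogonal : LinearMap.range (defect g V).toLinearMap =
    (⨆ i, closedRange (V i)).topologicalClosureᗮ := by
  ext x
  rw [mem_orthogonal_closure_iSup_closedRange]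
  refine ⟨?_, fun h => ⟨x, hV.defect_eq_self h⟩⟩
  rintro ⟨y, rfl⟩ i
  exact DFunLike.congr_fun (hV.star_mul_defect i) y

/-- Induction on `s`. Write `x = y + z` along the pure part and its complement. By induction `V_i*
x` lies in the pure part, hence so does `V_i* z`; it also lies in the complement, so `V_i* z = 0`.
Then `z = Δ z`, while `Δ` vanishes on the complement. -/
theorem mem_purePart_of_star_word_eq_zero (s : ℕ) {x : K}
    (hx : ∀ α ∈ words n s, star (word V α) x = 0) : x ∈ hV.purePart := by
  induction s generalizing x with
  | zero =>
    have h := hx 1 (mem_words.2 FreeMonoid.length_one)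
    rw [word_one, star_one] at h
    exact (show x = 0 from h) ▸ Submodule.zero_mem _
  | succ s ih =>
    have hc : CompleteSpace hV.purePart := hV.isClosed_purePart.completeSpace_coe
    have hd : Disjoint hV.purePart hV.purePartᗮ := Submodule.orthogonal_disjoint _
    obtain ⟨y, hy, z, hz, rfl⟩ :=
      Submodule.exists_add_mem_mem_orthogonal (K := hV.purePart) x
    have hz1 : ∀ i, star (V i) z = 0 := by
      intro i
      have h1 : star (V i) (y + z) ∈ hV.purePart := by
        refine ih fun α hα => ?_
        have h := hx (FreeMonoid.of i * α)
          (mem_words.2 (by rw [FreeMonoid.length_mul, mem_words.1 hα, FreeMonoid.length_of,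
            add_comm]))
        rwa [word_mul, word_of, star_mul, mul_apply_eq_comp] at h
      rw [map_add] at h1
      have h2 := Submodule.sub_mem _ h1 ((hV.reduces_purePart i).2 y hy)
      rw [add_sub_cancel_left] at h2
      exact Submodule.disjoint_def.1 hd _ h2 ((hV.reduces_purePart i).orthogonal.2 z hz)
    have hz2 := hV.mem_orthogonal_purePart_iff.1 hz 1
    rw [word_one, star_one] at hz2
    change defect g V z = 0 at hz2
    rw [hV.defect_eq_self hz1] at hz2
    rw [hz2, add_zero]
    exact hy

/-- One inclusion is the preceding lemma after passing to orthogonal complements. For the other,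
`V_α Δ y` is orthogonal to the ranges of all `V_β` with `|β| = |α| + 1`, so a vector `x` in the
intersection satisfies `Δ V_α* x = 0` for every `α`. -/
theorem orthogonal_purePart_eq_iInf : hV.purePartᗮ =
    ⨅ s, (⨆ α : words n s, closedRange (word V α.1)).topologicalClosure := by
  refine le_antisymm (le_iInf fun s => ?_) fun x hx => ?_
  · rw [← Submodule.orthogonal_orthogonal_eq_closure]
    refine Submodule.orthogonal_le fun x hx => ?_
    rw [← Submodule.orthogonal_closure, mem_orthogonal_closure_iSup_closedRange] at hx
    exact hV.mem_purePart_of_star_word_eq_zero s fun α hα => hx ⟨α, hα⟩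
  · rw [hV.mem_orthogonal_purePart_iff]
    intro α
    refine ext_inner_left ℂ fun y => ?_
    have hy : word V α (defect g V y) ∈
        (⨆ β : words n (α.length + 1), closedRange (word V β.1)).topologicalClosureᗮ := by
      rw [mem_orthogonal_closure_iSup_closedRange]
      rintro ⟨β, hβ⟩
      have hl := mem_words.1 hβ
      have hle : α.length ≤ β.length := by omega
      have hne : β ≠ α := by
        rintro rfl
        omega
      exact DFunLike.congr_fun (hV.star_word_mul_word_mul_defect_of_ne hle hne) y
    rw [inner_zero_right, ← hV.inner_defect_left, ContinuousLinearMap.star_eq_adjoint,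
      ContinuousLinearMap.adjoint_inner_right]
    exact Submodule.inner_left_of_mem_orthogonal ((Submodule.mem_iInf _).1 hx _) hy

end IsModelTuple

end NCDomain

theorem mainTheorem4 {n : ℕ} (g : WeightSeries n) (hg : IsAdmissible g)
    (hconv : ∃ D : Fock n ℂ →L[ℂ] Fock n ℂ,
      Tendsto (defectPartialSum g (universalModel g)) atTop (𝓝 D))
    {K : Type*} [NormedAddCommGroup K] [InnerProductSpace ℂ K] [CompleteSpace K]
    [TopologicalSpace.SeparableSpace K]
    (π : cstarModel g →⋆ₐ[ℂ] (K →L[ℂ] K)) (V : Fin n → K →L[ℂ] K) (hV : V = repTuple g π) :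
    ∃ hdom : InDomain g V, ∃ K₀ K₁ : Submodule ℂ K,
      K₀ = LinearMap.range (ContinuousLinearMap.adjoint (berezinKernel g V hdom)).toLinearMap ∧
      K₁ = LinearMap.ker (berezinKernel g V hdom).toLinearMap ∧
      IsPartialIsometry (berezinKernel g V hdom) ∧
      IsWoldDecomposition g V K₀ K₁ ∧
      IsStarProjection (defect g V) ∧
      LinearMap.range (defect g V).toLinearMap = defectSpace g V ∧
      (∃ U : K₀ ≃ₗᵢ[ℂ] Fock n (defectSpace g V),
        (∀ x : K₀, U x = berezinKernel g V hdom x) ∧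
        ∀ (i : Fin n) (x : K₀), V i x = U.symm (shift (defectSpace g V) g i (U x))) ∧
      (∀ M N : Submodule ℂ K, IsWoldDecomposition g V M N → M = K₀ ∧ N = K₁) ∧
      IsOrthogonalSum (fun α : FreeMonoid (Fin n) =>
        (LinearMap.range (defect g V).toLinearMap).map (word V α).toLinearMap) K₀ ∧
      (∃ R : Submodule ℂ K, IsOrthogonalSum (fun i => closedRange (V i)) R ∧
        LinearMap.range (defect g V).toLinearMap = Rᗮ) ∧
      (∃ R : ℕ → Submodule ℂ K,
        (∀ s, IsOrthogonalSum (fun α : words n s => closedRange (word V α.1)) (R s)) ∧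
        K₁ = ⨅ s, R s) := by
  have h : IsModelTuple g V := hV ▸ isModelTuple_repTuple g hconv π
  have hB := h.berezinKernel_eq h.inDomain
  refine ⟨h.inDomain, h.purePart, h.purePartᗮ, ?_, ?_, ?_, h.isWoldDecomposition,
    h.isStarProjection, h.range_defect, ?_, fun M N => h.eq_of_isWoldDecomposition,
    h.isOrthogonalSum_purePart,
    ⟨_, isOrthogonalSum_closedRange fun i j => h.star_mul_of_ne, h.range_defect_eq_orthogonal⟩,
    ⟨_, fun s => isOrthogonalSum_closedRange fun α β hne => ?_, h.orthogonal_purePart_eq_iInf⟩⟩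
  · rw [hB, ContinuousLinearMap.adjoint_adjoint]
    rfl
  · rw [hB, h.orthogonal_purePart]
  · intro x hx
    rw [hB] at hx ⊢
    have hc : CompleteSpace h.purePart := h.isClosed_purePart.completeSpace_coe
    -- The complement of the kernel is the closed range of the isometry, on which the adjoint
    -- inverts it.
    rw [← h.orthogonal_purePart, Submodule.orthogonal_orthogonal] at hx
    obtain ⟨f, rfl⟩ := hx
    change ‖h.woldAdjoint (h.woldIsometry f)‖ = ‖h.woldIsometry f‖
    rw [h.woldAdjoint_woldIsometry, h.woldIsometry.norm_map]
  · rw [hB]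
    -- The unitary is the inverse of the isometry onto its range; there it agrees with the adjoint,
    -- that is, with the Berezin kernel.
    have hU : ∀ x : h.purePart, h.woldIsometry.equivRange.symm x = h.woldAdjoint x := by
      intro x
      obtain ⟨f, rfl⟩ := h.woldIsometry.equivRange.surjective x
      rw [LinearIsometryEquiv.symm_apply_apply]
      exact (h.woldAdjoint_woldIsometry f).symm
    refine ⟨h.woldIsometry.equivRange.symm, hU, fun i x => ?_⟩
    obtain ⟨f, rfl⟩ := h.woldIsometry.equivRange.surjective x
    rw [LinearIsometryEquiv.symm_apply_apply]
    exact h.apply_woldIsometry i f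
  · exact h.star_word_mul_word α.1 β.1
      ((mem_words.1 α.2).trans (mem_words.1 β.2).symm) fun e => hne (Subtype.ext e)
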